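/- **Setting.** Let $\mathcal T$ be a finite rooted tree with node set $\mathcal V$ and root $1$. Its leaves are the $K$ actions $\mathcal A$; $\mathsf{pa}(i)$ and $\mathsf{ch}(i)$ are the parent and the children of node $i$, and the height $h_i$ is the largest length of a path from $i$ to a descendant (so $h_i=0$ exactly at the leaves). Let $\mu_1\in\mathbb R$, $\sigma>0$, $\sigma_{0,i}>0$ for $i\ne 1$, and $\sigma_{0,1}\ge 0$ ($\sigma_{0,1}=0$ means that the root is certain). The true parameters are drawn as $\theta_{*,1}\sim\mathcal N(\mu_1,\sigma_{0,1}^2)$ and $\theta_{*,i}\mid\theta_{*,\mathsf{pa}(i)}\sim\mathcal N(\theta_{*,\mathsf{pa}(i)},\sigma_{0,i}^2)$; taking action $A_t$ in round $t$ gives the reward $Y_t\sim\mathcal N(\theta_{*,A_t},\sigma^2)$. For a history of $t-1$ rounds let $\mathcal S_{t,a}$ be the set of earlier rounds in which action $a$ was taken, and define from the leaves up $$M_{t,i}=\frac{|\mathcal S_{t,i}|}{\sigma^2}\ (i\in\mathcal A),\qquad M_{t,i}=\sum_{j\in\mathsf{ch}(i)}\tilde\sigma_{t,j}^{-2}\ (i\notin\mathcal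 A),\qquad \tilde\sigma_{t,j}^2=\sigma_{0,j}^2+M_{t,j}^{-1},$$ $$\tilde\theta_{t,i}=\frac1{|\mathcal S_{t,i}|}\sum_{\ell\in\mathcal S_{t,i}}Y_\ell\ (i\in\mathcal A),\qquad \tilde\theta_{t,i}=M_{t,i}^{-1}\sum_{j\in\mathsf{ch}(i)}\tilde\sigma_{t,j}^{-2}\tilde\theta_{t,j}\ (i\notin\mathcal A),$$ $$\hat\sigma_{t,i}^{-2}=\sigma_{0,i}^{-2}+M_{t,i},\qquad \hat\theta_{t,i}(\theta_p)=\hat\sigma_{t,i}^2\bigl(\sigma_{0,i}^{-2}\theta_p+M_{t,i}\tilde\theta_{t,i}\bigr)$$ (with $\tilde\sigma_{t,j}^{-2}=0$ and $M_{t,i}\tilde\theta_{t,i}=0$ when nothing was observed below the node, and $\hat\sigma_{t,1}^2=0$, $\hat\theta_{t,1}(\mu_1)=\mu_1$ if $\sigma_{0,1}=0$). In round $t$, HierTS samples $\theta_{t,1}\sim\mathcal N(\hat\theta_{t,1}(\mu_1),\hat\sigma_{t,1}^2)$ and then, down the tree, $\theta_{t,i}\sim\mathcal N(\hat\theta_{t,i}(\theta_{t,\mathsf{pa}(i)}),\hat\sigma_{t,i}^2)$,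 and takes $A_t\in\arg\max_{a\in\mathcal A}\theta_{t,a}$, with any measurable tie-breaking rule. Its Bayes regret is $\mathcal{BR}(n)=\mathbb E\bigl[\sum_{t=1}^n(\max_{a\in\mathcal A}\theta_{*,a}-\theta_{*,A_t})\bigr]$. Let $\sigma_{\max}$ be the largest marginal prior standard deviation of an action, $\sigma_{\max}^2=\max_{a\in\mathcal A}\sum_{i}\sigma_{0,i}^2$ with the sum over the path from the root to $a$. Put $$w_i=\frac{\sigma_{0,i}^2}{\log(1+\sigma_{0,i}^2/\sigma^2)}\log\Bigl(1+\frac{\sigma_{0,i}^2n}{\sigma^2}\Bigr)\ (i\in\mathcal A),\qquad w_i=\frac{\sigma_{0,i}^2}{\log(1+\sigma_{0,i}^2/\sigma^2)}\log\Bigl(1+\sigma_{0,i}^2\sum_{j\in\mathsf{ch}(i)}\sigma_{0,j}^{-2}\Bigr)\ (i\notin\mathcal A),$$ with $w_1=0$ if $\sigma_{0,1}=0$, and for a scalar $c>0$ put $\mathcal G(n)=\sum_{i\in\mathcal V}c^{h_i}w_i$ and $$U(n,\delta)=\sqrt{2n\,\mathcal G(n)\log(1/\delta)}+\sqrt{2/\pi}\,\sigma_{\max}Kn\delta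 ,$$ where the first root is read as $0$ if $\delta>1$. **Theorem.** 1. Let $n\ge0$ and let $c>0$ satisfy $c\,\hat\sigma_{t,i}^{-2}\ge\hat\sigma_{t+1,i}^{-2}$ for every node $i$, every round $t\in[n]$ and every history. Then the $n$-round regret is integrable, and $\mathcal{BR}(n)\le U(n,\delta)$ for every $\delta>0$. 2. ($\tilde O(\sqrt{n|\mathcal V|})$ for $\delta=1/n$.) For all $0<\underline\sigma\le\overline\sigma$, $\sigma>0$ and $h\in\mathbb N$ there is a constant $C$ such that for every such tree of height at most $h$ with noise $\sigma$, with $\sigma_{0,i}\le\overline\sigma$ for all $i$ and $\sigma_{0,i}\ge\underline\sigma$ for all $i\ne1$, and every $n\ge1$, taking $c=1+\overline\sigma^2/\sigma^2$, $$\mathcal{BR}(n)\le U(n,1/n)\le C\sqrt{n|\mathcal V|}\,\log(1+n|\mathcal V|)+\sqrt{2/\pi}\,\sigma_{\max}K ,$$ and $U(n,1/n)\le C\sqrt{n|\mathcal V|}\,\log(1+n|\mathcal V|)$ if moreover $K\le n$. 3. (Flat $K$-armed bandit.) Let the tree have height $1$. For every fixed $c$, $\mathcal G(n)\to\sum_{a\in\mathcal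 A}w_a$ as $\sigma_{0,1}\to0^+$ with the other parameters fixed. If $\sigma_{0,1}=0$, then the arm means are independent with $\theta_{*,a}\sim\mathcal N(\mu_1,\sigma_{0,a}^2)$, HierTS samples the arms independently from the posteriors $\mathcal N\Bigl(\frac{\mu_1\sigma_{0,a}^{-2}+\sigma^{-2}\sum_{\ell\in\mathcal S_{t,a}}Y_\ell}{\sigma_{0,a}^{-2}+\sigma^{-2}|\mathcal S_{t,a}|},\frac{1}{\sigma_{0,a}^{-2}+\sigma^{-2}|\mathcal S_{t,a}|}\Bigr)$, that is, it is Thompson sampling for the flat bandit, $\sigma_{\max}=\max_a\sigma_{0,a}$, and for every $\delta>0$ $$\mathcal{BR}(n)\le\sqrt{2n\sum_{a\in\mathcal A}w_a\,\log(1/\delta)}+\sqrt{2/\pi}\,\sigma_{\max}Kn\delta .$$ -/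

import Mathlib

open MeasureTheory ProbabilityTheory Filter Topology

universe u

open scoped Classical in
/-- The children of the node `i` of a rooted tree. The tree is a rooted tree of Mathlib: the order
is the ancestor order, with the root `⊥` as its least element, and `Order.pred i` is the parent
of `i`. -/
noncomputable def children {T : RootedTree} [Fintype T] (i : T) : Finset T :=
  Finset.univ.filter fun j => i ⋖ j

theorem lt_of_mem_children {T : RootedTree} [Fintype T] {i j : T} (h : j ∈ children i) : i < j := by
  classical
  simp only [children, Finset.mem_filter] at h
  exact h.2.lt

/-- The action nodes, that is, the leaves of the tree. -/
abbrev Leaf (T : RootedTree) : Type _ := {i : T // IsMax i}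

instance (T : RootedTree) : MeasurableSpace (Leaf T) := ⊤

/-- The height of a node: the largest length of a path from the node to one of its descendants. -/
noncomputable def nodeHeight {T : RootedTree} (i : T) : ℕ := (Order.coheight i).toNat

/-- Top-down evaluation of a Gaussian hierarchy: the value of the root is
`m ⊥ μ + s ⊥ * ξ ⊥`, and the value of any other node `i` is `m i p + s i * ξ i`, where `p` is the
value of its parent. -/
noncomputable def treeEval {T : RootedTree} [Fintype T] (m : T → ℝ → ℝ) (s : T → ℝ) (μ : ℝ)
    (ξ : T → ℝ) (i : T) : ℝ :=
  open scoped Classical in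
  if _h : i = ⊥ then m i μ + s i * ξ i
  else m i (treeEval m s μ ξ (Order.pred i)) + s i * ξ i
termination_by wellFounded_lt.wrap i
decreasing_by exact Order.pred_lt_of_not_isMin (fun hm => _h hm.eq_bot)

/-- The law of a Gaussian hierarchy: the root is drawn from `N(m ⊥ μ, (s ⊥)²)` and, given the value
`p` of its parent, any other node `i` is drawn from `N(m i p, (s i)²)`; the noise variables
`(value of i) - m i p` of different nodes are independent. -/
noncomputable def treeLaw {T : RootedTree} [Fintype T] (m : T → ℝ → ℝ) (s : T → ℝ) (μ : ℝ) :
    Measure (T → ℝ) :=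
  (Measure.pi fun _ : T => gaussianReal 0 1).map (treeEval m s μ)

/-- Parameters of a `K`-armed Gaussian bandit with a tree hierarchy over its arms. -/
structure TreeBandit (T : RootedTree) where
  /-- the hyper-prior mean -/
  μ : ℝ
  /-- the conditional prior standard deviations of the nodes -/
  σ₀ : T → ℝ
  /-- the standard deviation of the reward noise -/
  σ : ℝ

namespace TreeBandit

variable {T : RootedTree} [Fintype T]

/-- The noise and all conditional prior widths are positive, except that the root may be certain
(`σ₀ ⊥ = 0`). -/
structure Valid (B : TreeBandit T) : Prop where
  noise_pos : 0 < B.σ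
  root_nonneg : 0 ≤ B.σ₀ ⊥
  node_pos : ∀ i, i ≠ ⊥ → 0 < B.σ₀ i

/-- The prior: `θ ⊥ ~ N(μ, (σ₀ ⊥)²)`, and `θ i ~ N(θ (pa i), (σ₀ i)²)` given its parent. -/
noncomputable def prior (B : TreeBandit T) : Measure (T → ℝ) :=
  treeLaw (fun _ p => p) B.σ₀ B.μ

/-- A history of `t` rounds: the actions and the rewards. -/
abbrev History (T : RootedTree) (t : ℕ) : Type _ := Fin t → Leaf T × ℝ

open scoped Classical in
/-- The rounds in which the node `i` was taken. -/
noncomputable def rounds {t : ℕ} (H : History T t) (i : T) : Finset (Fin t) :=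
  Finset.univ.filter fun l => ((H l).1 : T) = i

/-- The precision of the likelihood of the observations below the node `i`, as a function of the
value of `i`. For an action node it is `N / σ²`, where `N` is the number of observations; for any
other node it is the sum of `σ̃_j⁻²` over its children `j`, where `σ̃_j² = σ₀_j² + M_j⁻¹` and `M_j`
is the likelihood precision at `j`. Here `σ̃_j⁻²` is written as `M_j / (1 + σ₀_j² M_j)`, so that it
is `0` if there are no observations below `j`. -/
noncomputable def likPrec (B : TreeBandit T) {t : ℕ} (H : History T t) (i : T) : ℝ :=
  open scoped Classical in
  if IsMax i then (rounds H i).card / B.σ ^ 2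
  else ∑ j : {j // j ∈ children i},
    B.likPrec H j.1 / (1 + B.σ₀ j.1 ^ 2 * B.likPrec H j.1)
termination_by wellFounded_gt.wrap i
decreasing_by all_goals exact lt_of_mem_children j.2

/-- `σ̃_i⁻²`, the precision of the likelihood of the observations below the node `i`, as a function
of the value of the parent of `i`. -/
noncomputable def msgPrec (B : TreeBandit T) {t : ℕ} (H : History T t) (i : T) : ℝ :=
  B.likPrec H i / (1 + B.σ₀ i ^ 2 * B.likPrec H i)

/-- `θ̃_i`, the center of the likelihood of the observations below the node `i`: the mean reward at
an action node, and `M_i⁻¹ ∑ σ̃_j⁻² θ̃_j` over the children `j` at any other node. (If there are no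
observations below `i`, the value does not matter, as it is only used with the weight `0`.) -/
noncomputable def msgMean (B : TreeBandit T) {t : ℕ} (H : History T t) (i : T) : ℝ :=
  open scoped Classical in
  if IsMax i then ((rounds H i).card : ℝ)⁻¹ * ∑ l ∈ rounds H i, (H l).2
  else (B.likPrec H i)⁻¹ * ∑ j : {j // j ∈ children i}, B.msgPrec H j.1 * B.msgMean H j.1
termination_by wellFounded_gt.wrap i
decreasing_by exact lt_of_mem_children j.2

/-- The conditional posterior variance `σ̂_i² = (σ₀_i⁻² + M_i)⁻¹` of the node `i` given its parent,
written so that it is `0` if `σ₀_i = 0`. -/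
noncomputable def postVar (B : TreeBandit T) {t : ℕ} (H : History T t) (i : T) : ℝ :=
  B.σ₀ i ^ 2 / (1 + B.σ₀ i ^ 2 * B.likPrec H i)

/-- The conditional posterior mean `θ̂_i = σ̂_i² (σ₀_i⁻² p + M_i θ̃_i)` of the node `i` given the
value `p` of its parent, where `M_i θ̃_i = ∑ σ̃_j⁻² θ̃_j` over the children `j` if `i` is not an action
node, and `M_i θ̃_i` is the sum of the rewards of `i` divided by `σ²` if it is one. -/
noncomputable def postMean (B : TreeBandit T) {t : ℕ} (H : History T t) (i : T) (p : ℝ) : ℝ :=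
  (p + B.σ₀ i ^ 2 * (B.likPrec H i * B.msgMean H i)) / (1 + B.σ₀ i ^ 2 * B.likPrec H i)

/-- The law of the hierarchical sample of HierTS: the root is drawn from its posterior
`N(θ̂_1, σ̂_1²)`, then every other node from its posterior `N(θ̂_i, σ̂_i²)` given the value that was
sampled for its parent. -/
noncomputable def sampleLaw (B : TreeBandit T) {t : ℕ} (H : History T t) : Measure (T → ℝ) :=
  treeLaw (B.postMean H) (fun i => √(B.postVar H i)) B.μ

/-- `sel` is a (measurable) rule for choosing an action of maximal mean reward. -/
structure IsArgmax (sel : (T → ℝ) → Leaf T) : Prop where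
  measurable : Measurable sel
  le_sel : ∀ (θ : T → ℝ) (a : Leaf T), θ a ≤ θ (sel θ)

/-- The joint law of the true model parameters and of the history after `t` rounds of HierTS.
In a round, HierTS samples `s` from the hierarchical posterior given the history, takes the action
`sel s`, and observes a reward from `N(θ (sel s), σ²)`, where `θ` are the true parameters. -/
noncomputable def runLaw (B : TreeBandit T) (sel : (T → ℝ) → Leaf T) :
    (t : ℕ) → Measure ((T → ℝ) × History T t)
  | 0 => B.prior.map fun θ => (θ, Fin.elim0)
  | t + 1 => (B.runLaw sel t).bind fun x =>
      (B.sampleLaw x.2).bind fun s =>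
        (gaussianReal (x.1 (sel s)) (B.σ ^ 2).toNNReal).map fun y =>
          (x.1, Fin.snoc (α := fun _ => Leaf T × ℝ) x.2 (sel s, y))

/-- The regret of a history under the model parameters `θ`. -/
noncomputable def regret {n : ℕ} (x : (T → ℝ) × History T n) : ℝ :=
  ∑ t : Fin n, ((⨆ a : Leaf T, x.1 a) - x.1 (x.2 t).1)

/-- The `n`-round Bayes regret of HierTS. -/
noncomputable def bayesRegret (B : TreeBandit T) (sel : (T → ℝ) → Leaf T) (n : ℕ) : ℝ :=
  ∫ x, regret x ∂B.runLaw sel n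

/-- The condition `c σ̂_{t,i}⁻² ≥ σ̂_{t+1,i}⁻²` for every node `i` and every round `t ≤ n`, whatever
the history. Here `H` is a history after some round `t + 1 ≤ n`, and `Fin.init H` is the history
before that round. -/
def PosteriorScaling (B : TreeBandit T) (n : ℕ) (c : ℝ) : Prop :=
  ∀ t < n, ∀ (H : History T (t + 1)) (i : T),
    (B.postVar H i)⁻¹ ≤ c * (B.postVar (t := t) (Fin.init H) i)⁻¹

open scoped Classical in
/-- The weight `w_i` of the node `i`. -/
noncomputable def weight (B : TreeBandit T) (n : ℕ) (i : T) : ℝ :=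
  B.σ₀ i ^ 2 / Real.log (1 + B.σ₀ i ^ 2 / B.σ ^ 2) *
    if IsMax i then Real.log (1 + B.σ₀ i ^ 2 * n / B.σ ^ 2)
    else Real.log (1 + B.σ₀ i ^ 2 * ∑ j ∈ children i, (B.σ₀ j ^ 2)⁻¹)

/-- The complexity term `G(n)`. -/
noncomputable def complexity (B : TreeBandit T) (n : ℕ) (c : ℝ) : ℝ :=
  ∑ i, c ^ nodeHeight i * B.weight n i

open scoped Classical in
/-- The maximum marginal prior width (standard deviation) at an action node. The marginal prior
variance of an action is the sum of `σ₀_j²` over the path from the action to the root. -/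
noncomputable def sigmaMax (B : TreeBandit T) : ℝ :=
  ⨆ a : Leaf T, √(∑ j ∈ Finset.univ.filter (fun j : T => j ≤ a), B.σ₀ j ^ 2)

/-- The regret bound `√(2 n G log (1/δ)) + √(2/π) σ_max K n δ` with complexity term `G`. -/
noncomputable def bound (B : TreeBandit T) (n : ℕ) (G δ : ℝ) : ℝ :=
  √(2 * n * G * Real.log (1 / δ)) +
    √(2 / Real.pi) * B.sigmaMax * Nat.card (Leaf T) * n * δ

open scoped Classical in
/-- The same bandit with prior width `s` at the root. -/
noncomputable def withRoot (B : TreeBandit T) (s : ℝ) : TreeBandit T :=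
  { B with σ₀ := Function.update B.σ₀ ⊥ s }

end TreeBandit

/-! Thompson sampling works here because the hierarchical sample is an exact posterior draw.
Multiply the prior by the Gaussian likelihood and eliminate nodes from the leaves upwards. At an
eliminated node, completing the square turns the prior conditional into the posterior one and leaves
a Gaussian factor in the parent's value, with precision `msgPrec` and centre `msgMean`. Once every
node is eliminated, only a constant and `sampleLaw` remain (`lintegral_mul_likelihood`). The
algorithm chooses actions from the history alone, so the law of the run is likelihood times prior
over a reference measure on histories. Hence, given the history, the parameters are distributed as
the sample (`lintegral_runLaw_eq_sampleLaw`).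

In one round, parameters and sample are therefore i.i.d. given the history. The expected regret is
the expected excess of the best arm over its own posterior mean. This is at most `√(2 log (1/δ))`
posterior standard deviations of the arm played, plus Gaussian tails summed over the arms
(`lintegral_round_regret_le`).

It remains to bound the sum of posterior variances of the actions played, which can be done for each
history separately. The variance of an action is a sum over its path to the root: each node
contributes its conditional variance times the squared slopes of the conditional means below it. In
`mul_margVar_le` these squared slopes are compared with the gain in likelihood precision at the
node, each level costing a factor `c`. Concavity of the logarithm then turns each contribution into
an increment of `logGain`, up to `weightCoeff`. The increments telescope over the rounds, and the
final log gains are at most the logarithms in the weights. Cauchy–Schwarz over the rounds gives the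
square root.

For the order of the bound, one observation adds at most `1/σ²` to the likelihood precision of a
node, which makes `c = 1 + hi²/σ²` admissible. In the flat case a certain root has weight zero and
the arms decouple. -/

theorem pred_lt_of_ne_bot {T : RootedTree.{u}} {i : T} (h : i ≠ ⊥) : Order.pred i < i :=
  Order.pred_lt_of_not_isMin fun hm => h hm.eq_bot

/-! ### Gaussian hierarchies as functions of independent noise -/

section TreeEval

variable {T : RootedTree.{u}} [Fintype T]

/-- The value at the parent of `i`, or the initial value `μ` if `i` is the root. -/
noncomputable def parentEval (m : T → ℝ → ℝ) (s : T → ℝ) (μ : ℝ) (ξ : T → ℝ) (i : T) : ℝ :=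
  open scoped Classical in
  if i = ⊥ then μ else treeEval m s μ ξ (Order.pred i)

theorem treeEval_eq (m : T → ℝ → ℝ) (s : T → ℝ) (μ : ℝ) (ξ : T → ℝ) (i : T) :
    treeEval m s μ ξ i = m i (parentEval m s μ ξ i) + s i * ξ i := by
  rw [treeEval, parentEval]
  split_ifs <;> rfl

theorem treeEval_congr {m m' : T → ℝ → ℝ} {s s' : T → ℝ} {μ : ℝ} {ξ ξ' : T → ℝ} (i : T)
    (h : ∀ j ≤ i, m j = m' j ∧ s j = s' j ∧ ξ j = ξ' j) :
    treeEval m s μ ξ i = treeEval m' s' μ ξ' i := by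
  induction i using WellFoundedLT.induction with
  | ind i ih =>
    obtain ⟨h1, h2, h3⟩ := h i le_rfl
    rw [treeEval_eq, treeEval_eq, h1, h2, h3]
    congr 2
    unfold parentEval
    split_ifs with hi
    · rfl
    · have hlt := pred_lt_of_ne_bot hi
      exact ih _ hlt fun j hj => h j (hj.trans hlt.le)

theorem parentEval_congr {m m' : T → ℝ → ℝ} {s s' : T → ℝ} {μ : ℝ} {ξ ξ' : T → ℝ} (i : T)
    (h : ∀ j < i, m j = m' j ∧ s j = s' j ∧ ξ j = ξ' j) :
    parentEval m s μ ξ i = parentEval m' s' μ ξ' i := by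
  unfold parentEval
  split_ifs with hi
  · rfl
  · exact treeEval_congr _ fun j hj => h j (hj.trans_lt (pred_lt_of_ne_bot hi))

/-- Other nodes see `i` only through its value, so the mechanism producing that value is irrelevant
once the value is fixed. This allows prior and posterior hierarchies to be compared after clamping
one node. -/
theorem treeEval_congr_of_eq_at {m m' : T → ℝ → ℝ} {s s' : T → ℝ} {μ : ℝ} {ξ ξ' : T → ℝ} {i : T}
    (hi : treeEval m s μ ξ i = treeEval m' s' μ ξ' i)
    (h : ∀ j ≠ i, m j = m' j ∧ s j = s' j ∧ ξ j = ξ' j) :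
    treeEval m s μ ξ = treeEval m' s' μ ξ' := by
  funext k
  induction k using WellFoundedLT.induction with
  | ind k ih =>
    by_cases hk : k = i
    · rw [hk, hi]
    · obtain ⟨h1, h2, h3⟩ := h k hk
      rw [treeEval_eq, treeEval_eq, h1, h2, h3]
      congr 2
      unfold parentEval
      split_ifs with hb
      · rfl
      · exact ih _ (pred_lt_of_ne_bot hb)

theorem parentEval_update [DecidableEq T] (m : T → ℝ → ℝ) (s : T → ℝ) (μ : ℝ) (ξ : T → ℝ) (i : T)
    (x : ℝ) : parentEval m s μ (Function.update ξ i x) i = parentEval m s μ ξ i :=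
  parentEval_congr i fun _ hj => ⟨rfl, rfl, Function.update_of_ne hj.ne _ _⟩

theorem measurable_treeEval_apply {X : Type*} [MeasurableSpace X] {m : X → T → ℝ → ℝ}
    {s : X → T → ℝ} {μ : ℝ} (hm : ∀ i, Measurable fun p : X × ℝ => m p.1 i p.2)
    (hs : ∀ i, Measurable fun x => s x i) (i : T) :
    Measurable fun p : X × (T → ℝ) => treeEval (m p.1) (s p.1) μ p.2 i := by
  induction i using WellFoundedLT.induction with
  | ind i ih =>
    simp_rw [treeEval_eq]
    refine .add ?_ (((hs i).comp measurable_fst).mul (by fun_prop))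
    unfold parentEval
    split_ifs with hi
    · exact (hm i).comp (measurable_fst.prodMk measurable_const)
    · exact (hm i).comp (measurable_fst.prodMk (ih _ (pred_lt_of_ne_bot hi)))

theorem measurable_treeEval_prod {X : Type*} [MeasurableSpace X] {m : X → T → ℝ → ℝ}
    {s : X → T → ℝ} {μ : ℝ} (hm : ∀ i, Measurable fun p : X × ℝ => m p.1 i p.2)
    (hs : ∀ i, Measurable fun x => s x i) :
    Measurable fun p : X × (T → ℝ) => treeEval (m p.1) (s p.1) μ p.2 :=
  measurable_pi_iff.2 fun i => measurable_treeEval_apply hm hs i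

theorem measurable_treeEval {m : T → ℝ → ℝ} {s : T → ℝ} {μ : ℝ} (hm : ∀ i, Measurable (m i)) :
    Measurable (treeEval m s μ) :=
  (measurable_treeEval_prod (X := Unit) (m := fun _ => m) (s := fun _ => s)
    (fun i => (hm i).comp measurable_snd) fun _ => measurable_const).comp
    (measurable_const.prodMk measurable_id : Measurable fun ξ : T → ℝ => ((), ξ))

theorem isProbabilityMeasure_treeLaw {m : T → ℝ → ℝ} {s : T → ℝ} {μ : ℝ}
    (hm : ∀ i, Measurable (m i)) : IsProbabilityMeasure (treeLaw m s μ) :=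
  Measure.isProbabilityMeasure_map (measurable_treeEval hm).aemeasurable

theorem lintegral_treeLaw {m : T → ℝ → ℝ} {s : T → ℝ} {μ : ℝ} (hm : ∀ i, Measurable (m i))
    {f : (T → ℝ) → ENNReal} (hf : Measurable f) :
    ∫⁻ θ, f θ ∂treeLaw m s μ =
      ∫⁻ ξ, f (treeEval m s μ ξ) ∂Measure.pi fun _ : T => gaussianReal 0 1 := by
  rw [treeLaw, lintegral_map hf (measurable_treeEval hm)]

end TreeEval

/-! ### Resampling one coordinate of a product measure -/

/-- Resampling one coordinate independently does not change a product law. It is used to integrate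
out the noise of a single node with all other noises frozen. -/
theorem map_update_pi_prod {ι : Type*} [Fintype ι] [DecidableEq ι] (ν : ι → Measure ℝ)
    [∀ i, IsProbabilityMeasure (ν i)] (i : ι) :
    ((Measure.pi ν).prod (ν i)).map (fun p => Function.update p.1 i p.2) = Measure.pi ν := by
  have hmeas : Measurable fun p : (ι → ℝ) × ℝ => Function.update p.1 i p.2 := by
    refine measurable_pi_iff.2 fun j => ?_
    by_cases h : j = i
    · subst h; simpa using measurable_snd
    · simp only [Function.update_of_ne h]; fun_prop
  refine (Measure.pi_eq fun s hs => ?_).symm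
  rw [Measure.map_apply hmeas (MeasurableSet.univ_pi hs)]
  have : (fun p : (ι → ℝ) × ℝ => Function.update p.1 i p.2) ⁻¹' (Set.univ.pi s) =
      (Set.univ.pi (Function.update s i Set.univ)) ×ˢ s i := by
    ext p
    simp only [Set.mem_preimage, Set.mem_univ_pi, Set.mem_prod]
    constructor
    · intro h
      refine ⟨fun j => ?_, by simpa using h i⟩
      by_cases hj : j = i
      · subst hj; simp
      · simpa [hj] using h j
    · rintro ⟨h1, h2⟩ j
      by_cases hj : j = i
      · subst hj; simpa using h2
      · simpa [hj] using h1 j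
  rw [this, Measure.prod_prod, Measure.pi_pi, ← Finset.mul_prod_erase _ _ (Finset.mem_univ i),
    ← Finset.mul_prod_erase _ (fun j => ν j (s j)) (Finset.mem_univ i)]
  simp only [Function.update_self, measure_univ, one_mul]
  rw [mul_comm]
  congr 1
  refine Finset.prod_congr rfl fun j hj => ?_
  rw [Function.update_of_ne (Finset.ne_of_mem_erase hj)]

theorem lintegral_pi_update {ι : Type*} [Fintype ι] [DecidableEq ι] (ν : ι → Measure ℝ)
    [∀ i, IsProbabilityMeasure (ν i)] (i : ι) {f : (ι → ℝ) → ENNReal} (hf : Measurable f) :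
    ∫⁻ ξ, f ξ ∂Measure.pi ν = ∫⁻ ξ, ∫⁻ x, f (Function.update ξ i x) ∂ν i ∂Measure.pi ν := by
  have hmeas : Measurable fun p : (ι → ℝ) × ℝ => Function.update p.1 i p.2 := by
    refine measurable_pi_iff.2 fun j => ?_
    by_cases h : j = i
    · subst h; simpa using measurable_snd
    · simp only [Function.update_of_ne h]; fun_prop
  conv_lhs => rw [← map_update_pi_prod ν i, lintegral_map hf hmeas]
  exact lintegral_prod _ (hf.comp hmeas).aemeasurable

/-! ### Gaussian marginals of a hierarchy -/

section Marginal

variable {T : RootedTree.{u}} [Fintype T]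

/-- The variance of the value of the node `i` if the mean of a node is an affine function, with
slope `α`, of the value of its parent. -/
noncomputable def treeVar (α s : T → ℝ) (i : T) : ℝ :=
  treeEval (fun i v => α i ^ 2 * v + s i ^ 2) 0 0 0 i

theorem treeVar_bot (α s : T → ℝ) : treeVar α s ⊥ = s ⊥ ^ 2 := by
  rw [treeVar, treeEval_eq, parentEval]
  simp

theorem treeVar_of_ne_bot (α s : T → ℝ) {i : T} (hi : i ≠ ⊥) :
    treeVar α s i = α i ^ 2 * treeVar α s (Order.pred i) + s i ^ 2 := by
  rw [treeVar, treeEval_eq, parentEval]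
  simp [hi, treeVar]

theorem treeVar_nonneg (α s : T → ℝ) (i : T) : 0 ≤ treeVar α s i := by
  induction i using WellFoundedLT.induction with
  | ind i ih =>
    by_cases hi : i = ⊥
    · rw [hi, treeVar_bot]; positivity
    · rw [treeVar_of_ne_bot _ _ hi]
      have := ih _ (pred_lt_of_ne_bot hi)
      positivity

theorem lintegral_gaussianReal_affine (M : ℝ) {v : ℝ} (hv : 0 ≤ v) (a b s : ℝ) {f : ℝ → ENNReal}
    (hf : Measurable f) :
    ∫⁻ p, ∫⁻ x, f (a * p + b + s * x) ∂gaussianReal 0 1 ∂gaussianReal M v.toNNReal =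
      ∫⁻ x, f x ∂gaussianReal (a * M + b) (a ^ 2 * v + s ^ 2).toNNReal := by
  have h1 : (gaussianReal M v.toNNReal).map (fun p => a * p + b) =
      gaussianReal (a * M + b) (a ^ 2 * v).toNNReal := by
    rw [← Function.comp_def (fun x => x + b) (fun x => a * x),
      ← Measure.map_map (by fun_prop) (by fun_prop),
      gaussianReal_map_const_mul, gaussianReal_map_add_const]
    congr 1
    ext
    simp [hv, mul_nonneg (sq_nonneg a) hv]
  have h2 : (gaussianReal 0 1).map (fun x => s * x) = gaussianReal 0 (s ^ 2).toNNReal := by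
    rw [gaussianReal_map_const_mul]
    congr 1
    · simp
    · ext; simp [sq_nonneg s]
  have h3 : gaussianReal (a * M + b) (a ^ 2 * v + s ^ 2).toNNReal =
      gaussianReal (a * M + b) (a ^ 2 * v).toNNReal ∗ gaussianReal 0 (s ^ 2).toNNReal := by
    rw [gaussianReal_conv_gaussianReal, add_zero,
      Real.toNNReal_add (mul_nonneg (sq_nonneg a) hv) (sq_nonneg s)]
  rw [h3, Measure.lintegral_conv hf, ← h1, ← h2, lintegral_map _ (by fun_prop)]
  · refine lintegral_congr fun p => ?_
    rw [lintegral_map (by fun_prop) (by fun_prop)]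
  · exact Measurable.lintegral_prod_right' (f := fun q : ℝ × ℝ => f (q.1 + q.2)) (by fun_prop)

/-- Induction from the root: a node is an affine image of its Gaussian parent plus fresh independent
noise. The mean is obtained by running the hierarchy with all noise switched off. -/
theorem map_treeLaw_eval {m : T → ℝ → ℝ} {s α β : T → ℝ} {μ : ℝ}
    (hm : ∀ i p, m i p = α i * p + β i) (i : T) :
    (treeLaw m s μ).map (fun θ => θ i) =
      gaussianReal (treeEval m 0 μ 0 i) (treeVar α s i).toNNReal := by
  classical
  have hmeas : ∀ i, Measurable (m i) := fun i => by
    rw [show m i = fun p => α i * p + β i from funext (hm i)]; fun_prop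
  induction i using WellFoundedLT.induction with
  | ind i ih =>
    refine Measure.ext_of_lintegral _ fun f hf => ?_
    rw [lintegral_map hf (by fun_prop), lintegral_treeLaw hmeas (by fun_prop),
      lintegral_pi_update (f := fun ξ => f (treeEval m s μ ξ i)) _ i
        (hf.comp ((measurable_pi_apply i).comp (measurable_treeEval hmeas)))]
    simp_rw [treeEval_eq m s μ _ i, parentEval_update, hm, Function.update_self]
    by_cases hi : i = ⊥
    · subst hi
      simp only [parentEval, if_true, lintegral_const, measure_univ, mul_one]
      rw [treeVar_bot, treeEval_eq, hm]
      -- The root has no parent; its input `μ` is treated as a Gaussian of variance zero, that is, a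
      -- Dirac mass.
      have := lintegral_gaussianReal_affine μ le_rfl (α ⊥) (β ⊥) (s ⊥) hf
      simp only [Real.toNNReal_zero, gaussianReal_zero_var] at this
      rw [lintegral_dirac' _ (Measurable.lintegral_prod_right'
        (f := fun q : ℝ × ℝ => f (α ⊥ * q.1 + β ⊥ + s ⊥ * q.2)) (by fun_prop))] at this
      simpa [parentEval] using this
    · have hp := ih _ (pred_lt_of_ne_bot hi)
      rw [treeVar_of_ne_bot _ _ hi, treeEval_eq, hm]
      simp only [parentEval, hi, if_false, Pi.zero_apply, mul_zero, add_zero]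
      rw [← lintegral_gaussianReal_affine _ (treeVar_nonneg _ _ _) _ _ _ hf, ← hp,
        lintegral_map _ (by fun_prop), lintegral_treeLaw hmeas]
      · exact (Measurable.lintegral_prod_right'
          (f := fun q : ℝ × ℝ => f (α i * q.1 + β i + s i * q.2)) (by fun_prop)).comp
            (measurable_pi_apply _)
      · exact Measurable.lintegral_prod_right'
          (f := fun q : ℝ × ℝ => f (α i * q.1 + β i + s i * q.2)) (by fun_prop)

end Marginal

/-! ### Conjugacy at one node -/

/-- Completing the square for a Gaussian prior and a Gaussian likelihood. The integration variable
is the standardized noise rather than the value, so that `s = 0` (a certain root) needs no separate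
treatment. The test function `f` shows the posterior, and the exponential on the right is the
message passed to the parent. -/
theorem lintegral_gaussianReal_mul_exp (s M c p : ℝ) (hM : 0 ≤ M) {f : ℝ → ENNReal}
    (hf : Measurable f) :
    ∫⁻ x, f (p + s * x) * ENNReal.ofReal (Real.exp (-(M * (c - (p + s * x)) ^ 2) / 2))
        ∂gaussianReal 0 1 =
      ENNReal.ofReal (1 / √(1 + s ^ 2 * M)) *
        (ENNReal.ofReal (Real.exp (-(M / (1 + s ^ 2 * M) * (c - p) ^ 2) / 2)) *
          ∫⁻ x, f ((p + s ^ 2 * (M * c)) / (1 + s ^ 2 * M) + s / √(1 + s ^ 2 * M) * x)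
            ∂gaussianReal 0 1) := by
  set D := 1 + s ^ 2 * M with hD
  have hD0 : 0 < D := by positivity
  -- The noise tilted by the likelihood is again Gaussian, with centre `k` and variance `1 / D`.
  set k := s * M * (c - p) / D with hk
  have hr : 0 < √D := Real.sqrt_pos.2 hD0
  have hmap : (gaussianReal 0 1).map (fun x => k + x / √D) = gaussianReal k (1 / D).toNNReal := by
    rw [← Function.comp_def (fun x => k + x) (fun x => x / √D),
      ← Measure.map_map (by fun_prop) (by fun_prop),
      gaussianReal_map_div_const, gaussianReal_map_const_add]
    congr 1
    · simp
    · ext; simp [hD0.le, Real.sq_sqrt]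
  have hv : (1 / D).toNNReal ≠ 0 := by simpa using hD0
  have hR : ∫⁻ x, f ((p + s ^ 2 * (M * c)) / D + s / √D * x) ∂gaussianReal 0 1 =
      ∫⁻ x, f (p + s * x) ∂gaussianReal k (1 / D).toNNReal := by
    rw [← hmap, lintegral_map (by fun_prop) (by fun_prop)]
    refine lintegral_congr fun x => ?_
    congr 1
    rw [hk]
    field_simp
    rw [hD]
    ring
  rw [hR, gaussianReal_of_var_ne_zero _ hv, gaussianReal_of_var_ne_zero _ one_ne_zero,
    lintegral_withDensity_eq_lintegral_mul _ (by fun_prop) (by fun_prop),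
    lintegral_withDensity_eq_lintegral_mul _ (by fun_prop) (by fun_prop), ← mul_assoc,
    ← lintegral_const_mul _ (by fun_prop)]
  refine lintegral_congr fun x => ?_
  simp only [Pi.mul_apply, gaussianPDF]
  rw [← mul_assoc, ← ENNReal.ofReal_mul (by positivity), mul_right_comm,
    ← ENNReal.ofReal_mul (gaussianPDFReal_nonneg _ _ _),
    ← mul_assoc (ENNReal.ofReal _) (ENNReal.ofReal _) (f _),
    ← ENNReal.ofReal_mul (by positivity)]
  congr 2
  simp only [gaussianPDFReal, NNReal.coe_one, Real.coe_toNNReal _ (one_div_pos.2 hD0).le]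
  have h2 : √(2 * Real.pi * (1 / D)) = √(2 * Real.pi) / √D := by
    rw [mul_one_div, Real.sqrt_div (by positivity)]
  rw [h2, inv_div, mul_one]
  have h3 : Real.exp (-(x - 0) ^ 2 / (2 * 1)) * Real.exp (-(M * (c - (p + s * x)) ^ 2) / 2) =
      Real.exp (-(M / D * (c - p) ^ 2) / 2) * Real.exp (-(x - k) ^ 2 / (2 * (1 / D))) := by
    rw [← Real.exp_add, ← Real.exp_add]
    congr 1
    rw [hk]
    field_simp
    rw [hD]
    ring
  calc _ = (√(2 * Real.pi))⁻¹ * (Real.exp (-(x - 0) ^ 2 / (2 * 1)) *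
        Real.exp (-(M * (c - (p + s * x)) ^ 2) / 2)) := by simp only [mul_one]; ring
    _ = _ := by rw [h3]; field_simp

section Conjugacy

variable {T : RootedTree.{u}}

/-- The value of the parent of `i` in the configuration `θ`, or `μ` if `i` is the root. -/
noncomputable def parentValue (μ : ℝ) (θ : T → ℝ) (i : T) : ℝ :=
  open scoped Classical in
  if i = ⊥ then μ else θ (Order.pred i)

theorem parentValue_treeEval [Fintype T] (m : T → ℝ → ℝ) (s : T → ℝ) (μ : ℝ) (ξ : T → ℝ) (i : T) :
    parentValue μ (treeEval m s μ ξ) i = parentEval m s μ ξ i := rfl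

theorem measurable_parentValue (μ : ℝ) (i : T) :
    Measurable fun θ : T → ℝ => parentValue μ θ i := by
  unfold parentValue
  split_ifs <;> fun_prop

/-- With all noises but that of `i` frozen, the parent's value is a constant and the rest of the
tree is a function of the value at `i`. The one-dimensional identity then applies, and the message
factor comes out as a function of the parent. -/
theorem lintegral_treeLaw_mul_exp [Fintype T] {m m' : T → ℝ → ℝ} {s s' : T → ℝ} {μ M c : ℝ} {i : T}
    (hM : 0 ≤ M) (hmeas : ∀ j, Measurable (m j)) (hm : ∀ p, m i p = p)
    (hm' : ∀ p, m' i p = (p + s i ^ 2 * (M * c)) / (1 + s i ^ 2 * M))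
    (hs' : s' i = s i / √(1 + s i ^ 2 * M)) (hne : ∀ j ≠ i, m j = m' j ∧ s j = s' j)
    {g : (T → ℝ) → ENNReal} (hg : Measurable g) :
    ∫⁻ θ, g θ * ENNReal.ofReal (Real.exp (-(M * (c - θ i) ^ 2) / 2)) ∂treeLaw m s μ =
      ENNReal.ofReal (1 / √(1 + s i ^ 2 * M)) *
        ∫⁻ θ, g θ * ENNReal.ofReal
          (Real.exp (-(M / (1 + s i ^ 2 * M) * (c - parentValue μ θ i) ^ 2) / 2))
          ∂treeLaw m' s' μ := by
  classical
  have hmeas' : ∀ j, Measurable (m' j) := fun j => by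
    by_cases hj : j = i
    · rw [hj, show m' i = _ from funext hm']; fun_prop
    · rw [← (hne j hj).1]; exact hmeas j
  have hpar := measurable_parentValue (T := T) μ i
  rw [lintegral_treeLaw hmeas (by fun_prop), lintegral_treeLaw hmeas' (by fun_prop)]
  have htm := measurable_treeEval (s := s) (μ := μ) hmeas
  have htm' := measurable_treeEval (s := s') (μ := μ) hmeas'
  rw [lintegral_pi_update _ i (by fun_prop), lintegral_pi_update (f := fun ξ =>
      g (treeEval m' s' μ ξ) * ENNReal.ofReal (Real.exp (-(M / (1 + s i ^ 2 * M) *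
        (c - parentValue μ (treeEval m' s' μ ξ) i) ^ 2) / 2))) _ i (by fun_prop),
    ← lintegral_const_mul]
  swap
  · have hup : Measurable fun q : (T → ℝ) × ℝ => Function.update q.1 i q.2 := by
      refine measurable_pi_iff.2 fun j => ?_
      by_cases h : j = i
      · subst h; simpa using measurable_snd
      · simp only [Function.update_of_ne h]; fun_prop
    refine Measurable.lintegral_prod_right' (ν := gaussianReal 0 1) (f := fun q : (T → ℝ) × ℝ =>
      g (treeEval m' s' μ (Function.update q.1 i q.2)) * ENNReal.ofReal
        (Real.exp (-(M / (1 + s i ^ 2 * M) *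
          (c - parentValue μ (treeEval m' s' μ (Function.update q.1 i q.2)) i) ^ 2) / 2))) ?_
    fun_prop
  refine lintegral_congr fun ξ => ?_
  set p := parentEval m s μ ξ i with hp
  have hp' : parentEval m' s' μ ξ i = p :=
    parentEval_congr i fun j hj => ⟨(hne j hj.ne).1.symm, (hne j hj.ne).2.symm, rfl⟩
  -- `Θ v` is the configuration with node `i` clamped to `v`; its width is set to `0` so that its
  -- own noise has no effect. Both hierarchies are `Θ` evaluated at different laws of `v`.
  set Θ : ℝ → T → ℝ := fun v =>
    treeEval (Function.update m i fun _ => v) (Function.update s i 0) μ ξ with hΘ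
  have hΘm : Measurable Θ := by
    have h := (measurable_treeEval_prod (X := ℝ) (m := fun v => Function.update m i fun _ => v)
      (s := fun _ => Function.update s i 0) (μ := μ) (fun j => ?_) fun j => measurable_const).comp
      (measurable_id.prodMk (measurable_const (a := ξ)))
    · exact h
    · by_cases hj : j = i
      · subst hj; simpa using measurable_fst
      · simp only [Function.update_of_ne hj]
        exact (hmeas j).comp measurable_snd
  have e1 : ∀ x, treeEval m s μ (Function.update ξ i x) = Θ (p + s i * x) := fun x => by
    refine treeEval_congr_of_eq_at (i := i) ?_ fun j hj => ?_
    · rw [treeEval_eq, treeEval_eq, parentEval_update, hm]; simp [hp]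
    · simp [hj]
  have e2 : ∀ x, treeEval m' s' μ (Function.update ξ i x) = Θ (m' i p + s' i * x) := fun x => by
    refine treeEval_congr_of_eq_at (i := i) ?_ fun j hj => ?_
    · rw [treeEval_eq, treeEval_eq, parentEval_update, hp']; simp
    · simp [hj, hne j hj]
  have e3 : ∀ v, Θ v i = v := fun v => by
    simp only [hΘ]; rw [treeEval_eq]; simp
  have h := lintegral_gaussianReal_mul_exp (s i) M c p hM (hg.comp hΘm)
  simp_rw [parentValue_treeEval, parentEval_update, hp', e1, e2, e3, hm', hs']
  simp only [Function.comp] at h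
  rw [h, lintegral_mul_const' _ _ ENNReal.ofReal_ne_top]
  ring

end Conjugacy

namespace TreeBandit

variable {T : RootedTree.{u}} [Fintype T] (B : TreeBandit T) {t : ℕ} (H : History T t)

theorem likPrec_of_isMax {i : T} (hi : IsMax i) :
    B.likPrec H i = (rounds H i).card / B.σ ^ 2 := by
  rw [likPrec, if_pos hi]

theorem likPrec_of_not_isMax {i : T} (hi : ¬ IsMax i) :
    B.likPrec H i = ∑ j ∈ children i, B.msgPrec H j := by
  rw [likPrec, if_neg hi]
  exact Finset.sum_coe_sort (children i) fun j => B.msgPrec H j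

theorem msgMean_of_isMax {i : T} (hi : IsMax i) :
    B.msgMean H i = ((rounds H i).card : ℝ)⁻¹ * ∑ l ∈ rounds H i, (H l).2 := by
  rw [msgMean, if_pos hi]

theorem msgMean_of_not_isMax {i : T} (hi : ¬ IsMax i) :
    B.msgMean H i = (B.likPrec H i)⁻¹ * ∑ j ∈ children i, B.msgPrec H j * B.msgMean H j := by
  rw [msgMean, if_neg hi]
  congr 1
  exact Finset.sum_coe_sort (children i) fun j => B.msgPrec H j * B.msgMean H j

theorem likPrec_nonneg (i : T) : 0 ≤ B.likPrec H i := by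
  induction i using WellFoundedGT.induction with
  | ind i ih =>
    by_cases hi : IsMax i
    · rw [likPrec_of_isMax _ _ hi]; positivity
    · rw [likPrec_of_not_isMax _ _ hi]
      refine Finset.sum_nonneg fun j hj => ?_
      have := ih j (lt_of_mem_children hj)
      unfold msgPrec
      positivity

theorem msgPrec_nonneg (i : T) : 0 ≤ B.msgPrec H i := by
  have := B.likPrec_nonneg H i
  unfold msgPrec
  positivity

theorem one_add_mul_likPrec_pos (i : T) : 0 < 1 + B.σ₀ i ^ 2 * B.likPrec H i := by
  have := B.likPrec_nonneg H i
  positivity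

end TreeBandit

theorem mem_children {T : RootedTree.{u}} [Fintype T] {i j : T} : j ∈ children i ↔ i ⋖ j := by
  simp [children]

theorem covBy_iff_eq_pred {T : RootedTree.{u}} {i j : T} : i ⋖ j ↔ j ≠ ⊥ ∧ i = Order.pred j := by
  constructor
  · intro h
    refine ⟨fun hj => ?_, ?_⟩
    · exact (hj ▸ h.lt).not_ge bot_le
    · have h1 : i ≤ Order.pred j := Order.le_pred_of_lt h.lt
      by_contra hne
      have hj : j ≠ ⊥ := fun hj => (hj ▸ h.lt).not_ge bot_le
      exact h.2 (lt_of_le_of_ne h1 hne) (pred_lt_of_ne_bot hj)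
  · rintro ⟨hj, rfl⟩
    exact Order.pred_covBy_of_not_isMin fun hm => hj hm.eq_bot

/-- A weighted sum of squares is one square around the barycentre plus a constant. The centre enters
through `A * C`, so total weight zero (no observations) is allowed. -/
theorem sum_mul_sub_sq_eq {ι : Type*} (s : Finset ι) (a c : ι → ℝ) {A C : ℝ}
    (hA : A = ∑ j ∈ s, a j) (hC : A * C = ∑ j ∈ s, a j * c j) (v : ℝ) :
    ∑ j ∈ s, a j * (c j - v) ^ 2 = (∑ j ∈ s, a j * c j ^ 2 - A * C ^ 2) + A * (C - v) ^ 2 := by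
  have h : ∑ j ∈ s, a j * (c j - v) ^ 2 =
      ∑ j ∈ s, a j * c j ^ 2 - 2 * v * ∑ j ∈ s, a j * c j + v ^ 2 * ∑ j ∈ s, a j := by
    rw [Finset.mul_sum, Finset.mul_sum, ← Finset.sum_sub_distrib, ← Finset.sum_add_distrib]
    exact Finset.sum_congr rfl fun j _ => by ring
  rw [h, ← hA, ← hC]
  ring

/-! ### Bayes' formula by eliminating nodes from the leaves upwards -/

namespace TreeBandit

variable {T : RootedTree.{u}} (B : TreeBandit T) {t : ℕ} (H : History T t)

/-- The likelihood of the model parameters `θ`. -/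
noncomputable def likelihood (θ : T → ℝ) : ENNReal :=
  ∏ l, gaussianPDF (θ (H l).1) (B.σ ^ 2).toNNReal (H l).2

variable [Fintype T]

theorem likPrec_mul_msgMean_of_isMax {i : T} (hi : IsMax i) :
    B.likPrec H i * B.msgMean H i = ∑ l ∈ rounds H i, 1 / B.σ ^ 2 * (H l).2 := by
  rw [likPrec_of_isMax _ _ hi, msgMean_of_isMax _ _ hi, ← Finset.mul_sum]
  rcases (rounds H i).eq_empty_or_nonempty with h | h
  · simp [h]
  · have : ((rounds H i).card : ℝ) ≠ 0 := by simpa using h.ne_empty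
    field_simp

theorem likPrec_mul_msgMean_of_not_isMax {i : T} (hi : ¬ IsMax i) :
    B.likPrec H i * B.msgMean H i = ∑ j ∈ children i, B.msgPrec H j * B.msgMean H j := by
  rw [msgMean_of_not_isMax _ _ hi]
  -- If nothing was observed below `i`, the inverse in `msgMean` is a default value; all child
  -- weights are then zero, because they are nonnegative with sum zero.
  by_cases h : B.likPrec H i = 0
  · have h0 : ∀ j ∈ children i, B.msgPrec H j = 0 := by
      rw [likPrec_of_not_isMax _ _ hi] at h
      exact (Finset.sum_eq_zero_iff_of_nonneg fun j _ => B.msgPrec_nonneg H j).1 h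
    rw [h, zero_mul, Finset.sum_eq_zero fun j hj => by rw [h0 j hj, zero_mul]]
  · rw [mul_inv_cancel_left₀ h]

open scoped Classical in
/-- Twice the negative log-likelihood, up to a constant, of the observations that reach the node `k`
through leaves or through nodes of `S`, as a function of the value of `k`. -/
noncomputable def nodeEnergy (S : Finset T) (k : T) (v : ℝ) : ℝ :=
  if IsMax k then ∑ l ∈ rounds H k, 1 / B.σ ^ 2 * ((H l).2 - v) ^ 2
  else ∑ j ∈ children k with j ∈ S, B.msgPrec H j * (B.msgMean H j - v) ^ 2

theorem measurable_nodeEnergy (S : Finset T) (k : T) : Measurable (B.nodeEnergy H S k) := by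
  unfold nodeEnergy
  split_ifs <;> fun_prop

/-- Once all children of `i` have sent their messages, what `i` knows is a single quadratic in its
value. The constant `K` only affects the normalization. -/
theorem exists_nodeEnergy_eq {S : Finset T} {i : T} (hS : children i ⊆ S) :
    ∃ K : ℝ, ∀ v, B.nodeEnergy H S i v = K + B.likPrec H i * (B.msgMean H i - v) ^ 2 := by
  classical
  by_cases hi : IsMax i
  · refine ⟨∑ l ∈ rounds H i, 1 / B.σ ^ 2 * (H l).2 ^ 2 - B.likPrec H i * B.msgMean H i ^ 2,
      fun v => ?_⟩
    rw [nodeEnergy, if_pos hi]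
    refine sum_mul_sub_sq_eq _ _ _ ?_ (B.likPrec_mul_msgMean_of_isMax H hi) v
    rw [likPrec_of_isMax _ _ hi, Finset.sum_const, nsmul_eq_mul, mul_one_div]
  · refine ⟨∑ j ∈ children i, B.msgPrec H j * B.msgMean H j ^ 2 -
      B.likPrec H i * B.msgMean H i ^ 2, fun v => ?_⟩
    rw [nodeEnergy, if_neg hi, Finset.filter_true_of_mem fun j hj => hS hj]
    exact sum_mul_sub_sq_eq _ _ _ (B.likPrec_of_not_isMax H hi)
      (B.likPrec_mul_msgMean_of_not_isMax H hi) v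

open scoped Classical in
theorem nodeEnergy_insert {S : Finset T} {i : T} (hi : i ∉ S) (k : T) (v : ℝ) :
    B.nodeEnergy H (insert i S) k v = B.nodeEnergy H S k v +
      if k ⋖ i then B.msgPrec H i * (B.msgMean H i - v) ^ 2 else 0 := by
  unfold nodeEnergy
  split_ifs with h1 h2 h2
  · exact absurd h2.lt h1.not_lt
  · rw [add_zero]
  · have : {j ∈ children k | j ∈ insert i S} = insert i {j ∈ children k | j ∈ S} := by
      ext j
      simp only [Finset.mem_filter, Finset.mem_insert, mem_children]
      constructor
      · tauto
      · rintro (rfl | h)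
        · exact ⟨h2, Or.inl rfl⟩
        · exact ⟨h.1, Or.inr h.2⟩
    rw [this, Finset.sum_insert (by simp [hi]), add_comm]
  · rw [add_zero]
    congr 1
    ext j
    simp only [Finset.mem_filter, Finset.mem_insert, mem_children]
    constructor
    · rintro ⟨h, rfl | h'⟩
      · exact absurd h h2
      · exact ⟨h, h'⟩
    · tauto

open scoped Classical in
-- The message of `i` is received by exactly one place: its parent, which has not been eliminated,
-- or the constant `μ` if `i` is the root. The conditional term on the left accounts for the latter
-- case.
theorem sum_nodeEnergy_insert {S : Finset T} {i : T} (hi : i ∉ S)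
    (hp : i ≠ ⊥ → Order.pred i ∉ S) (μ : ℝ) (θ : T → ℝ) :
    ∑ k ∈ (insert i S)ᶜ, B.nodeEnergy H (insert i S) k (θ k) +
        (if i = ⊥ then B.msgPrec H i * (B.msgMean H i - μ) ^ 2 else 0) =
      ∑ k ∈ (insert i S)ᶜ, B.nodeEnergy H S k (θ k) +
        B.msgPrec H i * (B.msgMean H i - parentValue μ θ i) ^ 2 := by
  simp_rw [nodeEnergy_insert B H hi, Finset.sum_add_distrib, add_assoc]
  congr 1
  by_cases hb : i = ⊥
  · simp only [parentValue, hb, if_true]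
    rw [add_eq_right]
    refine Finset.sum_eq_zero fun k _ => if_neg fun h => ?_
    exact h.lt.not_ge bot_le
  · simp only [parentValue, hb, if_false, add_zero]
    rw [Finset.sum_eq_single (Order.pred i)]
    · rw [if_pos (covBy_iff_eq_pred.2 ⟨hb, rfl⟩)]
    · intro k _ hk
      exact if_neg fun h => hk (covBy_iff_eq_pred.1 h).2
    · intro h
      simp only [Finset.mem_compl, not_not, Finset.mem_insert] at h
      rcases h with h | h
      · exact absurd h (pred_lt_of_ne_bot hb).ne
      · exact absurd h (hp hb)

open scoped Classical in
/-- The posterior conditional means at the nodes of `S`, and the prior ones elsewhere. -/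
noncomputable def mixedMean (S : Finset T) (i : T) : ℝ → ℝ :=
  if i ∈ S then B.postMean H i else fun p => p

open scoped Classical in
/-- The posterior conditional widths at the nodes of `S`, and the prior ones elsewhere. -/
noncomputable def mixedWidth (S : Finset T) (i : T) : ℝ :=
  if i ∈ S then √(B.postVar H i) else B.σ₀ i

theorem measurable_postMean (i : T) : Measurable (B.postMean H i) := by
  unfold postMean
  fun_prop

theorem measurable_mixedMean (S : Finset T) (i : T) : Measurable (B.mixedMean H S i) := by
  unfold mixedMean
  split_ifs
  · exact B.measurable_postMean H i
  · exact measurable_id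

theorem sqrt_postVar {i : T} (hi : 0 ≤ B.σ₀ i) :
    √(B.postVar H i) = B.σ₀ i / √(1 + B.σ₀ i ^ 2 * B.likPrec H i) := by
  rw [postVar, Real.sqrt_div (sq_nonneg _), Real.sqrt_sq hi]

open scoped Classical in
-- One elimination: all children of `i` are already in `S` and its parent is not, so `i` still has
-- its prior conditional and its energy is one quadratic. The factor `Z` must not depend on `f`,
-- since it is later identified by a special choice of `f`.
theorem lintegral_mixed_step {S : Finset T} {i : T} (hi : i ∉ S) (hp : i ≠ ⊥ → Order.pred i ∉ S)
    (hc : children i ⊆ S) (hσ : 0 ≤ B.σ₀ i) :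
    ∃ Z : ENNReal, ∀ f : (T → ℝ) → ENNReal, Measurable f →
      ∫⁻ θ, f θ * ENNReal.ofReal (Real.exp (-(∑ k ∈ Sᶜ, B.nodeEnergy H S k (θ k)) / 2))
        ∂treeLaw (B.mixedMean H S) (B.mixedWidth H S) B.μ =
      Z * ∫⁻ θ, f θ * ENNReal.ofReal (Real.exp
          (-(∑ k ∈ (insert i S)ᶜ, B.nodeEnergy H (insert i S) k (θ k)) / 2))
        ∂treeLaw (B.mixedMean H (insert i S)) (B.mixedWidth H (insert i S)) B.μ := by
  obtain ⟨K, hK⟩ := B.exists_nodeEnergy_eq H hc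
  set κ : ℝ := if i = ⊥ then B.msgPrec H i * (B.msgMean H i - B.μ) ^ 2 else 0 with hκ
  have hme := B.measurable_nodeEnergy H
  have hw : B.mixedWidth H S i = B.σ₀ i := by simp [mixedWidth, hi]
  refine ⟨ENNReal.ofReal (1 / √(1 + B.σ₀ i ^ 2 * B.likPrec H i)) *
    ENNReal.ofReal (Real.exp (-(K + κ) / 2)), fun f hf => ?_⟩
  have hg : Measurable fun θ : T → ℝ => f θ * ENNReal.ofReal (Real.exp
      (-(K + ∑ k ∈ (insert i S)ᶜ, B.nodeEnergy H S k (θ k)) / 2)) := by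
    have : Measurable fun θ : T → ℝ => ∑ k ∈ (insert i S)ᶜ, B.nodeEnergy H S k (θ k) :=
      Finset.measurable_sum _ fun k _ => (hme S k).comp (measurable_pi_apply k)
    fun_prop
  have key := lintegral_treeLaw_mul_exp (m := B.mixedMean H S) (s := B.mixedWidth H S)
    (m' := B.mixedMean H (insert i S)) (s' := B.mixedWidth H (insert i S)) (μ := B.μ) (i := i)
    (c := B.msgMean H i) (B.likPrec_nonneg H i) (B.measurable_mixedMean H S)
    (fun p => by simp [mixedMean, hi]) (fun p => by simp [mixedMean, hw, postMean])
    (by rw [hw, ← B.sqrt_postVar H hσ]; simp [mixedWidth])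
    (fun j hj => by simp [mixedMean, mixedWidth, hj]) hg
  rw [hw] at key
  have hS : Sᶜ = insert i (insert i S)ᶜ := by
    ext j
    by_cases hj : j = i <;> simp [hj, hi]
  rw [mul_assoc, ← lintegral_const_mul' _ _ ENNReal.ofReal_ne_top]
  convert key using 2
  · funext θ
    rw [mul_assoc, ← ENNReal.ofReal_mul (Real.exp_nonneg _), ← Real.exp_add, hS,
      Finset.sum_insert (by simp), hK]
    congr 4
    ring
  · refine lintegral_congr fun θ => ?_
    have h := B.sum_nodeEnergy_insert H hi hp B.μ θ
    rw [mul_left_comm, mul_assoc, ← ENNReal.ofReal_mul (Real.exp_nonneg _),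
      ← ENNReal.ofReal_mul (Real.exp_nonneg _), ← Real.exp_add, ← Real.exp_add]
    congr 3
    rw [← hκ] at h
    simp only [msgPrec] at h
    linarith

open scoped Classical in
-- The eliminated nodes always form an upper set, so that every node is eliminated after its
-- descendants. Iterating the single elimination over such sets leads from the prior to the
-- posterior.
theorem lintegral_prior_mul_exp (hB : B.Valid) (S : Finset T) (hS : ∀ i ∈ S, ∀ j, i ≤ j → j ∈ S) :
    ∃ Z : ENNReal, ∀ f : (T → ℝ) → ENNReal, Measurable f →
      ∫⁻ θ, f θ * ENNReal.ofReal (Real.exp (-(∑ k, B.nodeEnergy H ∅ k (θ k)) / 2)) ∂B.prior =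
      Z * ∫⁻ θ, f θ * ENNReal.ofReal (Real.exp (-(∑ k ∈ Sᶜ, B.nodeEnergy H S k (θ k)) / 2))
        ∂treeLaw (B.mixedMean H S) (B.mixedWidth H S) B.μ := by
  have hσ : ∀ i, 0 ≤ B.σ₀ i := fun i => by
    by_cases hi : i = ⊥
    · rw [hi]; exact hB.root_nonneg
    · exact (hB.node_pos i hi).le
  induction S using Finset.strongInduction with
  | H S ih =>
    rcases S.eq_empty_or_nonempty with rfl | hne
    · refine ⟨1, fun f _ => ?_⟩
      rw [one_mul, prior, Finset.compl_empty]
      congr 1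
    -- A minimal node of `S` is the one eliminated last: its removal leaves an upper set, which
    -- contains its children but not its parent.
    · obtain ⟨i, hi, hmin⟩ := S.exists_minimal hne
      have herase : ∀ k ∈ S.erase i, ∀ j, k ≤ j → j ∈ S.erase i := fun k hk j hkj => by
        rw [Finset.mem_erase] at hk ⊢
        refine ⟨?_, hS k hk.2 j hkj⟩
        rintro rfl
        exact hk.1 (le_antisymm hkj (hmin hk.2 hkj))
      obtain ⟨Z₁, hZ₁⟩ := ih _ (Finset.erase_ssubset hi) herase
      obtain ⟨Z₂, hZ₂⟩ := B.lintegral_mixed_step H (S := S.erase i) (i := i) (by simp)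
        (fun hb h => by
          have hlt := pred_lt_of_ne_bot hb
          exact (hmin (Finset.mem_of_mem_erase h) hlt.le).not_gt hlt)
        (fun j hj => by
          have hlt := lt_of_mem_children hj
          exact Finset.mem_erase.2 ⟨hlt.ne', hS i hi j hlt.le⟩) (hσ i)
      rw [Finset.insert_erase hi] at hZ₂
      exact ⟨Z₁ * Z₂, fun f hf => by rw [hZ₁ f hf, hZ₂ f hf, mul_assoc]⟩

theorem isProbabilityMeasure_sampleLaw : IsProbabilityMeasure (B.sampleLaw H) :=
  isProbabilityMeasure_treeLaw (B.measurable_postMean H)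

theorem isProbabilityMeasure_prior : IsProbabilityMeasure B.prior :=
  isProbabilityMeasure_treeLaw fun _ => measurable_id

theorem likelihood_eq (θ : T → ℝ) : B.likelihood H θ =
    ENNReal.ofReal (√(2 * Real.pi * B.σ ^ 2))⁻¹ ^ t *
      ENNReal.ofReal (Real.exp (-(∑ k, B.nodeEnergy H ∅ k (θ k)) / 2)) := by
  classical
  have h1 : ∑ k, B.nodeEnergy H ∅ k (θ k) =
      ∑ l, 1 / B.σ ^ 2 * ((H l).2 - θ (H l).1) ^ 2 := by
    rw [← Finset.sum_fiberwise (s := Finset.univ) (g := fun l => ((H l).1 : T))]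
    refine Finset.sum_congr rfl fun k _ => ?_
    unfold nodeEnergy
    split_ifs with hk
    · rw [rounds]
      refine Finset.sum_congr (by ext; simp) fun l hl => ?_
      rw [(Finset.mem_filter.1 hl).2]
    · rw [Finset.sum_eq_zero, Finset.sum_eq_zero]
      · intro l hl
        exact absurd ((Finset.mem_filter.1 hl).2 ▸ (H l).1.2) hk
      · simp
  have h2 : ∀ l, gaussianPDF (θ (H l).1) (B.σ ^ 2).toNNReal (H l).2 =
      ENNReal.ofReal (√(2 * Real.pi * B.σ ^ 2))⁻¹ *
        ENNReal.ofReal (Real.exp (-(1 / B.σ ^ 2 * ((H l).2 - θ (H l).1) ^ 2) / 2)) := fun l => by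
    rw [gaussianPDF, gaussianPDFReal, Real.coe_toNNReal _ (sq_nonneg _),
      ENNReal.ofReal_mul (by positivity)]
    congr 3
    rw [mul_comm (2 : ℝ) (B.σ ^ 2), ← div_div, one_div_mul_eq_div, neg_div]
  rw [likelihood, h1, Finset.prod_congr rfl fun l _ => h2 l, Finset.prod_mul_distrib,
    Finset.prod_const, Finset.card_univ, Fintype.card_fin,
    ← ENNReal.ofReal_prod_of_nonneg fun _ _ => Real.exp_nonneg _, ← Real.exp_sum,
    ← Finset.sum_neg_distrib, Finset.sum_div]

/-- Bayes' formula: the posterior of the model parameters is the law of the hierarchical sample. -/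
theorem lintegral_mul_likelihood (hB : B.Valid) {f : (T → ℝ) → ENNReal} (hf : Measurable f) :
    ∫⁻ θ, f θ * B.likelihood H θ ∂B.prior =
      (∫⁻ θ, B.likelihood H θ ∂B.prior) * ∫⁻ θ, f θ ∂B.sampleLaw H := by
  classical
  obtain ⟨Z, hZ⟩ := B.lintegral_prior_mul_exp H hB Finset.univ fun _ _ _ _ => Finset.mem_univ _
  have hlaw : treeLaw (B.mixedMean H Finset.univ) (B.mixedWidth H Finset.univ) B.μ =
      B.sampleLaw H := by
    rw [sampleLaw]
    congr 1 <;> funext i <;> simp [mixedMean, mixedWidth]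
  simp only [Finset.compl_univ, Finset.sum_empty, neg_zero, zero_div, Real.exp_zero,
    ENNReal.ofReal_one, mul_one, hlaw] at hZ
  have hpow : ENNReal.ofReal (√(2 * Real.pi * B.σ ^ 2))⁻¹ ^ t ≠ ⊤ :=
    ENNReal.pow_ne_top ENNReal.ofReal_ne_top
  have key : ∀ g : (T → ℝ) → ENNReal, Measurable g → ∫⁻ θ, g θ * B.likelihood H θ ∂B.prior =
      ENNReal.ofReal (√(2 * Real.pi * B.σ ^ 2))⁻¹ ^ t * (Z * ∫⁻ θ, g θ ∂B.sampleLaw H) := by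
    intro g hg
    simp_rw [likelihood_eq, mul_left_comm (g _)]
    rw [lintegral_const_mul' _ _ hpow, hZ g hg]
  have := B.isProbabilityMeasure_sampleLaw H
  -- The test function `1` identifies the normalizing constant as the evidence.
  have h1 := key (fun _ => 1) measurable_const
  simp only [one_mul, lintegral_const, measure_univ, mul_one] at h1
  rw [key f hf, h1, ← mul_assoc]

end TreeBandit

/-! ### Measurable dependence of measures on parameters -/

theorem measurable_measure_map {X Y Z : Type*} [MeasurableSpace X] [MeasurableSpace Y]
    [MeasurableSpace Z] {κ : X → Measure Y} (hκ : Measurable κ) [∀ x, IsProbabilityMeasure (κ x)]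
    {F : X → Y → Z} (hF : Measurable (Function.uncurry F)) :
    Measurable fun x => (κ x).map (F x) := by
  let K : Kernel X Y := ⟨κ, hκ⟩
  have : IsMarkovKernel K := ⟨fun x => inferInstanceAs (IsProbabilityMeasure (κ x))⟩
  refine Measure.measurable_of_measurable_coe _ fun s hs => ?_
  have h : ∀ x, (κ x).map (F x) s = K x (Prod.mk x ⁻¹' (Function.uncurry F ⁻¹' s)) := fun x => by
    rw [Measure.map_apply hF.of_uncurry_left hs]; rfl
  simp_rw [h]
  exact Kernel.measurable_kernel_prodMk_left (hF hs)

theorem measurable_measure_bind {X Y Z : Type*} [MeasurableSpace X] [MeasurableSpace Y]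
    [MeasurableSpace Z] {κ : X → Measure Y} (hκ : Measurable κ) [∀ x, IsProbabilityMeasure (κ x)]
    {η : X → Y → Measure Z} (hη : Measurable (Function.uncurry η)) :
    Measurable fun x => (κ x).bind (η x) := by
  let K : Kernel X Y := ⟨κ, hκ⟩
  have : IsMarkovKernel K := ⟨fun x => inferInstanceAs (IsProbabilityMeasure (κ x))⟩
  refine Measure.measurable_of_measurable_coe _ fun s hs => ?_
  have h : ∀ x, (κ x).bind (η x) s = ∫⁻ y, η x y s ∂K x := fun x => by
    rw [Measure.bind_apply hs hη.of_uncurry_left.aemeasurable]; rfl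
  simp_rw [h]
  exact Measurable.lintegral_kernel_prod_right ((Measure.measurable_coe hs).comp hη)

theorem measurable_lintegral_of_measurable {X Y : Type*} [MeasurableSpace X] [MeasurableSpace Y]
    {κ : X → Measure Y} (hκ : Measurable κ) [∀ x, IsProbabilityMeasure (κ x)]
    {f : X → Y → ENNReal} (hf : Measurable (Function.uncurry f)) :
    Measurable fun x => ∫⁻ y, f x y ∂κ x := by
  let K : Kernel X Y := ⟨κ, hκ⟩
  have : IsMarkovKernel K := ⟨fun x => inferInstanceAs (IsProbabilityMeasure (κ x))⟩
  exact Measurable.lintegral_kernel_prod_right (κ := K) hf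

theorem measurable_map_volume {X Y Z : Type*} [MeasurableSpace X] [MeasurableSpace Y]
    [MeasurableSpace Z] {F : X → Y → ℝ → Z}
    (hF : Measurable fun p : (X × Y) × ℝ => F p.1.1 p.1.2 p.2) :
    Measurable (Function.uncurry fun x y => (volume : Measure ℝ).map (F x y)) := by
  refine Measure.measurable_of_measurable_coe _ fun u hu => ?_
  have h : ∀ p : X × Y, (volume : Measure ℝ).map (F p.1 p.2) u = volume (Prod.mk p ⁻¹'
      ((fun p : (X × Y) × ℝ => F p.1.1 p.1.2 p.2) ⁻¹' u)) := fun p =>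
    Measure.map_apply (hF.comp (measurable_prodMk_left (x := p))) hu
  simp only [Function.uncurry_def, h]
  exact measurable_measure_prodMk_left (hF hu)

instance discreteMeasurableSpace_leaf (T : RootedTree.{u}) : DiscreteMeasurableSpace (Leaf T) :=
  ⟨fun _ => trivial⟩

theorem measurable_eval_leaf {T : RootedTree.{u}} [Fintype T] :
    Measurable fun p : (T → ℝ) × Leaf T => p.1 p.2 :=
  measurable_from_prod_countable_left fun a => measurable_pi_apply (a : T)

/-! ### The law of the run and the posterior given the history -/

namespace TreeBandit

variable {T : RootedTree.{u}}

theorem measurable_snoc {t : ℕ} : Measurable fun p : History T t × (Leaf T × ℝ) =>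
    (Fin.snoc (α := fun _ => Leaf T × ℝ) p.1 p.2 : History T (t + 1)) := by
  refine measurable_pi_iff.2 fun l => ?_
  induction l using Fin.lastCases with
  | last => simpa using measurable_snd
  | cast l => simp only [Fin.snoc_castSucc]; fun_prop

variable {t : ℕ}

open scoped Classical in
theorem measurable_sum_rounds (i : T) {g : Leaf T × ℝ → ℝ} (hg : Measurable g) :
    Measurable fun H : History T t => ∑ l ∈ rounds H i, g (H l) := by
  simp_rw [rounds, Finset.sum_filter]
  refine Finset.measurable_sum _ fun l _ => Measurable.ite ?_ (by fun_prop) measurable_const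
  exact (measurable_fst.comp (measurable_pi_apply l))
    (MeasurableSet.of_discrete (s := {a : Leaf T | (a : T) = i}))

theorem measurable_card_rounds (i : T) :
    Measurable fun H : History T t => ((rounds H i).card : ℝ) := by
  simpa using measurable_sum_rounds (t := t) i (g := fun _ => 1) measurable_const

variable {sel : (T → ℝ) → Leaf T}

theorem measurable_snoc_sel (hsel : Measurable sel) :
    Measurable fun p : (History T t × (T → ℝ)) × ℝ =>
      (Fin.snoc (α := fun _ => Leaf T × ℝ) p.1.1 (sel p.1.2, p.2) : History T (t + 1)) :=
  measurable_snoc.comp ((measurable_fst.comp measurable_fst).prodMk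
    ((hsel.comp (measurable_snd.comp measurable_fst)).prodMk measurable_snd))

theorem likelihood_snoc (B : TreeBandit T) (H : History T t) (a : Leaf T) (y : ℝ) (θ : T → ℝ) :
    B.likelihood (Fin.snoc (α := fun _ => Leaf T × ℝ) H (a, y) : History T (t + 1)) θ =
      B.likelihood H θ * gaussianPDF (θ a) (B.σ ^ 2).toNNReal y := by
  rw [likelihood, Fin.prod_univ_castSucc]
  simp only [Fin.snoc_castSucc, Fin.snoc_last, likelihood]

theorem measurable_likelihood_apply (B : TreeBandit T) (H : History T t) :
    Measurable (B.likelihood H) := by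
  unfold likelihood
  refine Finset.measurable_prod _ fun l _ => ?_
  have h : Measurable fun θ : T → ℝ => (θ (H l).1, (B.σ ^ 2).toNNReal, (H l).2) := by fun_prop
  exact measurable_uncurry_gaussianPDF.comp h

variable [Fintype T] (B : TreeBandit T)

theorem measurable_likPrec (i : T) : Measurable fun H : History T t => B.likPrec H i := by
  induction i using WellFoundedGT.induction with
  | ind i ih =>
    by_cases hi : IsMax i
    · simp_rw [likPrec_of_isMax _ _ hi]
      exact (measurable_card_rounds i).div_const _
    · simp_rw [likPrec_of_not_isMax _ _ hi, msgPrec]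
      refine Finset.measurable_sum _ fun j hj => ?_
      have := ih j (lt_of_mem_children hj)
      fun_prop

theorem measurable_msgPrec (i : T) : Measurable fun H : History T t => B.msgPrec H i := by
  have := B.measurable_likPrec (t := t) i
  unfold msgPrec
  fun_prop

theorem measurable_msgMean (i : T) : Measurable fun H : History T t => B.msgMean H i := by
  induction i using WellFoundedGT.induction with
  | ind i ih =>
    by_cases hi : IsMax i
    · simp_rw [msgMean_of_isMax _ _ hi]
      exact (measurable_card_rounds i).inv.mul (measurable_sum_rounds i measurable_snd)
    · simp_rw [msgMean_of_not_isMax _ _ hi]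
      exact (B.measurable_likPrec i).inv.mul (Finset.measurable_sum _ fun j hj =>
        (B.measurable_msgPrec j).mul (ih j (lt_of_mem_children hj)))

theorem measurable_postVar (i : T) : Measurable fun H : History T t => B.postVar H i := by
  have := B.measurable_likPrec (t := t) i
  unfold postVar
  fun_prop

theorem measurable_postMean_prod (i : T) :
    Measurable fun p : History T t × ℝ => B.postMean p.1 i p.2 := by
  have := B.measurable_likPrec (t := t) i
  have := B.measurable_msgMean (t := t) i
  unfold postMean
  fun_prop

theorem measurable_sampleLaw : Measurable fun H : History T t => B.sampleLaw H := by
  refine measurable_measure_map (κ := fun _ : History T t => Measure.pi fun _ : T =>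
    gaussianReal 0 1) measurable_const (F := fun H ξ => treeEval (B.postMean H)
      (fun i => √(B.postVar H i)) B.μ ξ) ?_
  exact measurable_treeEval_prod (B.measurable_postMean_prod)
    fun i => (B.measurable_postVar i).sqrt

attribute [local instance] isProbabilityMeasure_sampleLaw isProbabilityMeasure_prior

theorem measurable_observe (hsel : Measurable sel) :
    Measurable (Function.uncurry fun (x : (T → ℝ) × History T t) (s : T → ℝ) =>
      (gaussianReal (x.1 (sel s)) (B.σ ^ 2).toNNReal).map fun y =>
        (x.1, (Fin.snoc (α := fun _ => Leaf T × ℝ) x.2 (sel s, y) : History T (t + 1)))) := by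
  refine measurable_measure_map
    (κ := fun p : ((T → ℝ) × History T t) × (T → ℝ) =>
      gaussianReal (p.1.1 (sel p.2)) (B.σ ^ 2).toNNReal)
    (F := fun p y => (p.1.1, (Fin.snoc (α := fun _ => Leaf T × ℝ) p.1.2 (sel p.2, y) :
      History T (t + 1)))) ?_ ?_
  · have h : Measurable fun p : ((T → ℝ) × History T t) × (T → ℝ) => p.1.1 (sel p.2) :=
      measurable_eval_leaf.comp ((measurable_fst.comp measurable_fst).prodMk
        (hsel.comp measurable_snd))
    exact measurable_gaussianReal.comp (h.prodMk measurable_const)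
  · refine Measurable.prodMk (by fun_prop) (measurable_snoc.comp (Measurable.prodMk ?_ ?_))
    · fun_prop
    · exact (hsel.comp (measurable_snd.comp measurable_fst)).prodMk measurable_snd

theorem lintegral_runLaw_succ (hsel : Measurable sel)
    {f : (T → ℝ) × History T (t + 1) → ENNReal} (hf : Measurable f) :
    ∫⁻ x, f x ∂B.runLaw sel (t + 1) =
      ∫⁻ x, ∫⁻ s, ∫⁻ y, f (x.1, Fin.snoc (α := fun _ => Leaf T × ℝ) x.2 (sel s, y))
        ∂gaussianReal (x.1 (sel s)) (B.σ ^ 2).toNNReal ∂B.sampleLaw x.2 ∂B.runLaw sel t := by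
  have ho := B.measurable_observe (t := t) hsel
  rw [runLaw, Measure.lintegral_bind (measurable_measure_bind
    (κ := fun x : (T → ℝ) × History T t => B.sampleLaw x.2)
    (B.measurable_sampleLaw.comp measurable_snd) ho).aemeasurable hf.aemeasurable]
  refine lintegral_congr fun x => ?_
  rw [Measure.lintegral_bind ho.of_uncurry_left.aemeasurable hf.aemeasurable]
  refine lintegral_congr fun s => ?_
  rw [lintegral_map hf]
  exact measurable_const.prodMk (measurable_snoc.comp (measurable_const.prodMk
    (measurable_const.prodMk measurable_id)))

theorem measurable_likelihood :
    Measurable fun p : (T → ℝ) × History T t => B.likelihood p.2 p.1 := by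
  unfold likelihood
  refine Finset.measurable_prod _ fun l _ => ?_
  have h1 : Measurable fun p : (T → ℝ) × History T t => p.1 (p.2 l).1 :=
    measurable_eval_leaf.comp (Measurable.prodMk (by fun_prop) (by fun_prop))
  exact measurable_uncurry_gaussianPDF.comp (h1.prodMk (measurable_const.prodMk (by fun_prop)))

/-- The law of the reward depends on `θ`, which blocks Fubini. Writing it as a density against
Lebesgue measure moves that dependence into the likelihood factor, and the integrals commute. -/
theorem lintegral_lintegral_gaussianReal_swap (hsel : Measurable sel) {v : NNReal} (hv : v ≠ 0)
    (P Q : Measure (T → ℝ)) [IsProbabilityMeasure P] [IsProbabilityMeasure Q]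
    {g : (T → ℝ) → (T → ℝ) → ℝ → ENNReal}
    (hg : Measurable fun p : ((T → ℝ) × (T → ℝ)) × ℝ => g p.1.1 p.1.2 p.2)
    {ℓ : (T → ℝ) → ENNReal} (hℓ : Measurable ℓ) :
    ∫⁻ θ, (∫⁻ s, ∫⁻ y, g θ s y ∂gaussianReal (θ (sel s)) v ∂Q) * ℓ θ ∂P =
      ∫⁻ s, ∫⁻ y, ∫⁻ θ, g θ s y * (ℓ θ * gaussianPDF (θ (sel s)) v y) ∂P ∂volume ∂Q := by
  have hpdf : Measurable fun p : ((T → ℝ) × (T → ℝ)) × ℝ =>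
      gaussianPDF (p.1.1 (sel p.1.2)) v p.2 := by
    have h1 : Measurable fun p : ((T → ℝ) × (T → ℝ)) × ℝ => p.1.1 (sel p.1.2) :=
      measurable_eval_leaf.comp (Measurable.prodMk (by fun_prop)
        (hsel.comp (measurable_snd.comp measurable_fst)))
    exact measurable_uncurry_gaussianPDF.comp (h1.prodMk (measurable_const.prodMk measurable_snd))
  have e1 : ∀ θ : T → ℝ, (∫⁻ s, ∫⁻ y, g θ s y ∂gaussianReal (θ (sel s)) v ∂Q) * ℓ θ =
      ∫⁻ s, ∫⁻ y, g θ s y * (ℓ θ * gaussianPDF (θ (sel s)) v y) ∂volume ∂Q := fun θ => by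
    have hm : Measurable fun s => ∫⁻ y, g θ s y ∂gaussianReal (θ (sel s)) v := by
      refine measurable_lintegral_of_measurable (κ := fun s =>
        gaussianReal (θ (sel s)) v) (f := fun s y => g θ s y) ?_ ?_
      · have h1 : Measurable fun s => θ (sel s) :=
          measurable_eval_leaf.comp (measurable_const.prodMk hsel)
        exact measurable_gaussianReal.comp (h1.prodMk measurable_const)
      · exact hg.comp ((measurable_const.prodMk measurable_fst).prodMk measurable_snd)
    rw [← lintegral_mul_const _ hm]
    refine lintegral_congr fun s => ?_
    have hfy : Measurable fun y => g θ s y := hg.comp (measurable_prodMk_left (x := (θ, s)))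
    rw [← lintegral_mul_const _ hfy, gaussianReal_of_var_ne_zero _ hv,
      lintegral_withDensity_eq_lintegral_mul _ (by fun_prop) (by fun_prop)]
    refine lintegral_congr fun y => ?_
    rw [Pi.mul_apply]
    ring
  have hF : Measurable fun p : ((T → ℝ) × (T → ℝ)) × ℝ =>
      g p.1.1 p.1.2 p.2 * (ℓ p.1.1 * gaussianPDF (p.1.1 (sel p.1.2)) v p.2) :=
    hg.mul ((hℓ.comp (measurable_fst.comp measurable_fst)).mul hpdf)
  rw [lintegral_congr e1, lintegral_lintegral_swap]
  · refine lintegral_congr fun s => ?_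
    rw [lintegral_lintegral_swap]
    exact (hF.comp ((measurable_fst.prodMk measurable_const).prodMk measurable_snd)).aemeasurable
  · exact (Measurable.lintegral_prod_right' hF).aemeasurable

theorem measurable_lintegral_observe {X X' : Type*} [MeasurableSpace X] [MeasurableSpace X']
    (hsel : Measurable sel) (v : NNReal) {κ : X → Measure (T → ℝ)} (hκ : Measurable κ)
    [∀ x, IsProbabilityMeasure (κ x)] {F : X → (T → ℝ) → ℝ → X'}
    (hF : Measurable fun p : (X × (T → ℝ)) × ℝ => F p.1.1 p.1.2 p.2)
    {f : (T → ℝ) × X' → ENNReal} (hf : Measurable f) :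
    Measurable fun x : (T → ℝ) × X => ∫⁻ s, ∫⁻ y, f (x.1, F x.2 s y)
      ∂gaussianReal (x.1 (sel s)) v ∂κ x.2 := by
  refine measurable_lintegral_of_measurable (κ := fun x : (T → ℝ) × X => κ x.2)
    (hκ.comp measurable_snd)
    (f := fun x s => ∫⁻ y, f (x.1, F x.2 s y) ∂gaussianReal (x.1 (sel s)) v) ?_
  refine measurable_lintegral_of_measurable
    (κ := fun p : ((T → ℝ) × X) × (T → ℝ) => gaussianReal (p.1.1 (sel p.2)) v)
    (f := fun p y => f (p.1.1, F p.1.2 p.2 y)) ?_ ?_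
  · have h1 : Measurable fun p : ((T → ℝ) × X) × (T → ℝ) => p.1.1 (sel p.2) :=
      measurable_eval_leaf.comp ((measurable_fst.comp measurable_fst).prodMk
        (hsel.comp measurable_snd))
    exact measurable_gaussianReal.comp (h1.prodMk measurable_const)
  · exact hf.comp (Measurable.prodMk (by fun_prop) (hF.comp (Measurable.prodMk
      (Measurable.prodMk (by fun_prop) (by fun_prop)) (by fun_prop))))

/-- Exchanging the order in which the parameters and the observation are integrated in one round. -/
theorem lintegral_observe_eq {X X' : Type*} [MeasurableSpace X] [MeasurableSpace X']
    (hsel : Measurable sel) {v : NNReal} (hv : v ≠ 0) (P : Measure (T → ℝ))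
    [IsProbabilityMeasure P] {κ : X → Measure (T → ℝ)} (hκ : Measurable κ)
    [∀ x, IsProbabilityMeasure (κ x)] {F : X → (T → ℝ) → ℝ → X'}
    (hF : Measurable fun p : (X × (T → ℝ)) × ℝ => F p.1.1 p.1.2 p.2)
    {L : (T → ℝ) × X → ENNReal} (hL : Measurable L) {L' : (T → ℝ) × X' → ENNReal}
    (hL' : Measurable L')
    (hLL' : ∀ θ x s y, L' (θ, F x s y) = L (θ, x) * gaussianPDF (θ (sel s)) v y)
    (ρ : Measure X) {f : (T → ℝ) × X' → ENNReal} (hf : Measurable f) :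
    ∫⁻ x, ∫⁻ θ, (∫⁻ s, ∫⁻ y, f (θ, F x s y) ∂gaussianReal (θ (sel s)) v ∂κ x) * L (θ, x) ∂P ∂ρ =
      ∫⁻ x, ∫⁻ θ, f (θ, x) * L' (θ, x) ∂P
        ∂(ρ.bind fun x => (κ x).bind fun s => volume.map (F x s)) := by
  have hmap := measurable_map_volume hF
  have hg : Measurable fun x => ∫⁻ θ, f (θ, x) * L' (θ, x) ∂P :=
    Measurable.lintegral_prod_left' (f := fun p => f p * L' p) (hf.mul hL')
  rw [Measure.lintegral_bind (measurable_measure_bind hκ hmap).aemeasurable hg.aemeasurable]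
  refine lintegral_congr fun x => ?_
  rw [Measure.lintegral_bind hmap.of_uncurry_left.aemeasurable hg.aemeasurable]
  refine (lintegral_lintegral_gaussianReal_swap hsel hv P (κ x)
    (g := fun θ s y => f (θ, F x s y))
    (hf.comp (Measurable.prodMk (by fun_prop) (hF.comp ((measurable_const.prodMk
      (measurable_snd.comp measurable_fst)).prodMk measurable_snd))))
    (ℓ := fun θ => L (θ, x)) (hL.comp (measurable_id.prodMk measurable_const))).trans ?_
  refine lintegral_congr fun s => ?_
  have hs : Measurable (F x s) := hF.comp (measurable_prodMk_left (x := (x, s)))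
  rw [lintegral_map hg hs]
  exact lintegral_congr fun y => lintegral_congr fun θ => by rw [hLL']

/-- Under `ρ` the actions are chosen by HierTS and the rewards are "drawn" from Lebesgue measure, so
`ρ` need not be finite. The action probabilities depend on the history only and are part of `ρ`; the
parameters enter through the likelihood alone. -/
theorem exists_lintegral_runLaw_eq (hB : B.Valid) (hsel : Measurable sel) (t : ℕ) :
    ∃ ρ : Measure (History T t), ∀ f : (T → ℝ) × History T t → ENNReal, Measurable f →
      ∫⁻ x, f x ∂B.runLaw sel t = ∫⁻ H, ∫⁻ θ, f (θ, H) * B.likelihood H θ ∂B.prior ∂ρ := by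
  induction t with
  | zero =>
    refine ⟨Measure.dirac Fin.elim0, fun f hf => ?_⟩
    rw [runLaw, lintegral_map hf (by fun_prop), lintegral_dirac' _
      (Measurable.lintegral_prod_left' (f := fun p => f p * B.likelihood p.2 p.1)
        (hf.mul B.measurable_likelihood))]
    simp [likelihood]
  | succ t ih =>
    obtain ⟨ρ, hρ⟩ := ih
    have hv : (B.σ ^ 2).toNNReal ≠ 0 := by simpa using hB.noise_pos.ne'
    have hsnoc := measurable_snoc_sel (t := t) hsel
    refine ⟨ρ.bind fun H => (B.sampleLaw H).bind fun s => volume.map fun y =>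
      Fin.snoc (α := fun _ => Leaf T × ℝ) H (sel s, y), fun f hf => ?_⟩
    rw [B.lintegral_runLaw_succ hsel hf, hρ]
    · exact lintegral_observe_eq (κ := B.sampleLaw) hsel hv B.prior B.measurable_sampleLaw hsnoc
        B.measurable_likelihood B.measurable_likelihood
        (fun θ H s y => B.likelihood_snoc H (sel s) y θ) ρ hf
    · exact measurable_lintegral_observe (κ := B.sampleLaw) (F := fun H s y =>
        Fin.snoc (α := fun _ => Leaf T × ℝ) H (sel s, y)) hsel _ B.measurable_sampleLaw hsnoc hf

/-- Given the history, the model parameters have the law of the hierarchical sample. -/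
theorem lintegral_runLaw_eq_sampleLaw (hB : B.Valid) (hsel : Measurable sel)
    {f : (T → ℝ) × History T t → ENNReal} (hf : Measurable f) :
    ∫⁻ x, f x ∂B.runLaw sel t =
      ∫⁻ x, ∫⁻ θ, f (θ, x.2) ∂B.sampleLaw x.2 ∂B.runLaw sel t := by
  obtain ⟨ρ, hρ⟩ := B.exists_lintegral_runLaw_eq hB hsel t
  have h1 : Measurable fun H : History T t => ∫⁻ θ, f (θ, H) ∂B.sampleLaw H :=
    measurable_lintegral_of_measurable B.measurable_sampleLaw (f := fun H θ => f (θ, H))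
      (hf.comp (measurable_snd.prodMk measurable_fst))
  -- Both sides are disintegrated over `ρ`; for each fixed history they agree by Bayes' formula.
  refine (hρ f hf).trans (Eq.trans ?_ (hρ _ (h1.comp measurable_snd)).symm)
  refine lintegral_congr fun H => ?_
  have hfH : Measurable fun θ => f (θ, H) := hf.comp measurable_prodMk_right
  have e := B.lintegral_mul_likelihood H hB hfH
  refine e.trans ?_
  rw [mul_comm]
  exact (lintegral_const_mul _ (B.measurable_likelihood_apply H)).symm

theorem isProbabilityMeasure_runLaw (hsel : Measurable sel) (t : ℕ) :
    IsProbabilityMeasure (B.runLaw sel t) := by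
  induction t with
  | zero => exact Measure.isProbabilityMeasure_map (by fun_prop)
  | succ t ih =>
    refine ⟨?_⟩
    rw [← lintegral_one, B.lintegral_runLaw_succ hsel measurable_const]
    simp

end TreeBandit

/-! ### Sum of posterior variances along a fixed history -/

section Tree

variable {T : RootedTree.{u}}

theorem nodeHeight_of_isMax {i : T} (hi : IsMax i) : nodeHeight i = 0 := by
  rw [nodeHeight, Order.coheight_eq_zero.2 hi]; rfl

/-- `nodeHeight` uses `toNat`, which sends `⊤` to `0`; finiteness makes it a faithful height. -/
theorem coheight_lt_top [Fintype T] (i : T) : Order.coheight i < ⊤ := by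
  refine lt_of_le_of_lt (Order.coheight_le fun p _ => ?_) (ENat.natCast_lt_top (Fintype.card T))
  exact_mod_cast p.length_lt_card.le

theorem nodeHeight_lt_of_lt [Fintype T] {i j : T} (h : i < j) : nodeHeight j < nodeHeight i := by
  have h1 := ENat.toNat_le_toNat (Order.coheight_add_one_le h) (coheight_lt_top i).ne
  rwa [ENat.toNat_add (coheight_lt_top j).ne ENat.one_ne_top] at h1

end Tree

/-- The quotient `log (1 + x) / x` decreases in `x`, here by Bernoulli's inequality with exponent `x
/ X ≤ 1`. It converts a bounded variance into a logarithm. -/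
theorem mul_log_le_log_mul {x X : ℝ} (hx : 0 ≤ x) (hX : x ≤ X) :
    x * Real.log (1 + X) ≤ X * Real.log (1 + x) := by
  rcases (hx.trans hX).eq_or_lt with h0 | h0
  · have : x = 0 := le_antisymm (h0 ▸ hX) hx
    simp [this, ← h0]
  · have h := rpow_one_add_le_one_add_mul_self (s := X) (p := x / X) (by linarith)
      (by positivity) ((div_le_one h0).2 hX)
    rw [div_mul_cancel₀ _ h0.ne'] at h
    have h2 := Real.log_le_log (by positivity) h
    rw [Real.log_rpow (by linarith)] at h2
    calc x * Real.log (1 + X) = X * (x / X * Real.log (1 + X)) := by field_simp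
      _ ≤ _ := by gcongr

theorem log_one_add_mul_le {C x : ℝ} (hC : 1 ≤ C) (hx : 0 ≤ x) :
    Real.log (1 + C * x) ≤ C * Real.log (1 + x) := by
  have h := one_add_mul_self_le_rpow_one_add (s := x) (p := C) (by linarith) hC
  have h2 := Real.log_le_log (by positivity) h
  rwa [Real.log_rpow (by linarith)] at h2

theorem div_one_add_sub_div_one_add {s x y : ℝ} (hx : 0 < 1 + s * x) (hy : 0 < 1 + s * y) :
    y / (1 + s * y) - x / (1 + s * x) = (y - x) / ((1 + s * x) * (1 + s * y)) := by
  rw [div_sub_div _ _ hy.ne' hx.ne', mul_comm (1 + s * x)]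
  congr 1
  ring

namespace TreeBandit

variable {T : RootedTree.{u}} {t : ℕ}

open scoped Classical in
theorem card_rounds_succ (H : History T (t + 1)) (i : T) :
    (rounds H i).card = (rounds (t := t) (Fin.init H) i).card +
      if ((H (Fin.last t)).1 : T) = i then 1 else 0 := by
  simp only [rounds, Finset.card_filter]
  rw [Fin.sum_univ_castSucc]
  rfl

/-- The prefactor of the weight of the node `i`. -/
noncomputable def weightCoeff (B : TreeBandit T) (i : T) : ℝ :=
  B.σ₀ i ^ 2 / Real.log (1 + B.σ₀ i ^ 2 / B.σ ^ 2)

theorem weightCoeff_nonneg (B : TreeBandit T) (i : T) : 0 ≤ B.weightCoeff i :=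
  div_nonneg (sq_nonneg _) (Real.log_nonneg (by
    have : 0 ≤ B.σ₀ i ^ 2 / B.σ ^ 2 := by positivity
    linarith))

variable [Fintype T] (B : TreeBandit T)

theorem msgPrec_sub_msgPrec_init (H : History T (t + 1)) (j : T) :
    B.msgPrec H j - B.msgPrec (t := t) (Fin.init H) j =
      (B.likPrec H j - B.likPrec (t := t) (Fin.init H) j) /
        ((1 + B.σ₀ j ^ 2 * B.likPrec (t := t) (Fin.init H) j) *
          (1 + B.σ₀ j ^ 2 * B.likPrec H j)) :=
  div_one_add_sub_div_one_add (B.one_add_mul_likPrec_pos _ j) (B.one_add_mul_likPrec_pos _ j)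

theorem likPrec_init_le (H : History T (t + 1)) (i : T) :
    B.likPrec (t := t) (Fin.init H) i ≤ B.likPrec H i := by
  classical
  induction i using WellFoundedGT.induction with
  | ind i ih =>
    by_cases hi : IsMax i
    · rw [likPrec_of_isMax _ _ hi, likPrec_of_isMax _ _ hi, card_rounds_succ]
      gcongr
      simp
    · rw [likPrec_of_not_isMax _ _ hi, likPrec_of_not_isMax _ _ hi]
      refine Finset.sum_le_sum fun j hj => ?_
      have h1 := ih j (lt_of_mem_children hj)
      rw [← sub_nonneg, msgPrec_sub_msgPrec_init]
      have h2 := B.one_add_mul_likPrec_pos (t := t) (Fin.init H) j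
      have h3 := B.one_add_mul_likPrec_pos H j
      exact div_nonneg (sub_nonneg.2 h1) (by positivity)

theorem msgPrec_init_le (H : History T (t + 1)) (i : T) :
    B.msgPrec (t := t) (Fin.init H) i ≤ B.msgPrec H i := by
  have h1 := B.likPrec_init_le H i
  rw [← sub_nonneg, msgPrec_sub_msgPrec_init]
  have h2 := B.one_add_mul_likPrec_pos (t := t) (Fin.init H) i
  have h3 := B.one_add_mul_likPrec_pos H i
  exact div_nonneg (sub_nonneg.2 h1) (by positivity)

/-- The slope of the conditional posterior mean of the node `i` as a function of its parent. -/
noncomputable def postSlope (H : History T t) (i : T) : ℝ :=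
  1 / (1 + B.σ₀ i ^ 2 * B.likPrec H i)

/-- The posterior variance of the node `i`. -/
noncomputable def margVar (H : History T t) (i : T) : ℝ :=
  treeVar (B.postSlope H) (fun j => √(B.postVar H j)) i

theorem margVar_nonneg (H : History T t) (i : T) : 0 ≤ B.margVar H i := treeVar_nonneg _ _ _

theorem postVar_nonneg (H : History T t) (i : T) : 0 ≤ B.postVar H i :=
  div_nonneg (sq_nonneg _) (B.one_add_mul_likPrec_pos H i).le

theorem margVar_bot (H : History T t) : B.margVar H ⊥ = B.postVar H ⊥ := by
  rw [margVar, treeVar_bot, Real.sq_sqrt (B.postVar_nonneg H ⊥)]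

theorem margVar_of_ne_bot (H : History T t) {i : T} (hi : i ≠ ⊥) :
    B.margVar H i = B.postSlope H i ^ 2 * B.margVar H (Order.pred i) + B.postVar H i := by
  rw [margVar, treeVar_of_ne_bot _ _ hi, Real.sq_sqrt (B.postVar_nonneg H i), margVar]

/-- The logarithm of the precision gain of the node `i` over its conditional prior. -/
noncomputable def logGain (H : History T t) (i : T) : ℝ :=
  Real.log (1 + B.σ₀ i ^ 2 * B.likPrec H i)

theorem logGain_init_le (H : History T (t + 1)) (i : T) :
    B.logGain (t := t) (Fin.init H) i ≤ B.logGain H i := by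
  have := B.likPrec_init_le H i
  refine Real.log_le_log (B.one_add_mul_likPrec_pos _ i) ?_
  gcongr

/-- Put `x = P V / σ²` and `X = σ₀² / σ²`, so `x ≤ X` and concavity bounds `P V` by `weightCoeff`
times `log (1 + x)`. The hypothesis on `P` gives `x ≤ C V (M' - M)`, and `1 + V (M' - M)` is exactly
the ratio of the precisions after and before the round, whose logarithm is the increment of
`logGain`. -/
theorem mul_postVar_le (hσ : 0 < B.σ) (H : History T (t + 1)) {i : T} (hi : 0 < B.σ₀ i) {P C : ℝ}
    (hP : 0 ≤ P) (hP1 : P ≤ 1) (hC : 1 ≤ C)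
    (hPC : P ≤ C * B.σ ^ 2 * (B.likPrec H i - B.likPrec (t := t) (Fin.init H) i)) :
    P * B.postVar (t := t) (Fin.init H) i ≤
      C * (B.weightCoeff i * (B.logGain H i - B.logGain (t := t) (Fin.init H) i)) := by
  have hD := B.one_add_mul_likPrec_pos (t := t) (Fin.init H) i
  have hD' := B.one_add_mul_likPrec_pos H i
  have hM := B.likPrec_nonneg (t := t) (Fin.init H) i
  have hv := B.postVar_nonneg (t := t) (Fin.init H) i
  have hle := B.likPrec_init_le H i
  set M := B.likPrec (t := t) (Fin.init H) i
  set M' := B.likPrec H i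
  set V := B.postVar (t := t) (Fin.init H) i with hV
  have hV' : V = B.σ₀ i ^ 2 / (1 + B.σ₀ i ^ 2 * M) := rfl
  set X := B.σ₀ i ^ 2 / B.σ ^ 2 with hX
  have hX0 : 0 < X := by positivity
  have hlogX : 0 < Real.log (1 + X) := Real.log_pos (by linarith)
  set x := P * V / B.σ ^ 2 with hx
  have hVle : V ≤ B.σ₀ i ^ 2 := by
    rw [hV']
    exact div_le_self (sq_nonneg _) (by have : 0 ≤ B.σ₀ i ^ 2 * M := by positivity
                                        linarith)
  have hxX : x ≤ X := by
    rw [hx, hX]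
    gcongr
    calc P * V ≤ 1 * V := by gcongr
      _ ≤ _ := by rwa [one_mul]
  have hx0 : 0 ≤ x := by positivity
  have h1 := mul_log_le_log_mul hx0 hxX
  have h2 : Real.log (1 + x) ≤ C * (B.logGain H i - B.logGain (t := t) (Fin.init H) i) := by
    have hlog : B.logGain H i - B.logGain (t := t) (Fin.init H) i =
        Real.log (1 + V * (M' - M)) := by
      rw [logGain, logGain, ← Real.log_div hD'.ne' hD.ne']
      congr 1
      rw [hV']
      field_simp
      ring
    rw [hlog]
    refine le_trans (Real.log_le_log (by positivity) ?_)
      (log_one_add_mul_le hC (mul_nonneg hv (sub_nonneg.2 hle)))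
    have : x ≤ C * (V * (M' - M)) := by
      rw [hx, div_le_iff₀ (by positivity)]
      calc P * V ≤ C * B.σ ^ 2 * (M' - M) * V := by gcongr
        _ = _ := by ring
    linarith
  have hPx : P * V = B.σ ^ 2 * x := by rw [hx]; field_simp
  have hw : B.weightCoeff i = B.σ ^ 2 * X / Real.log (1 + X) := by
    rw [weightCoeff, ← hX]
    congr 1
    rw [hX]
    field_simp
  rw [hPx, hw]
  calc B.σ ^ 2 * x ≤ B.σ ^ 2 * (X * Real.log (1 + x) / Real.log (1 + X)) := by
        gcongr
        rwa [le_div_iff₀ hlogX]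
    _ ≤ B.σ ^ 2 * (X * (C * (B.logGain H i - B.logGain (t := t) (Fin.init H) i)) /
        Real.log (1 + X)) := by gcongr
    _ = _ := by ring

theorem one_add_mul_likPrec_le_of_scaling (H : History T (t + 1)) {i : T} (hi : 0 < B.σ₀ i) {c : ℝ}
    (h : (B.postVar H i)⁻¹ ≤ c * (B.postVar (t := t) (Fin.init H) i)⁻¹) :
    1 + B.σ₀ i ^ 2 * B.likPrec H i ≤
      c * (1 + B.σ₀ i ^ 2 * B.likPrec (t := t) (Fin.init H) i) := by
  rw [postVar, postVar, inv_div, inv_div, ← mul_div_assoc] at h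
  exact (div_le_div_iff_of_pos_right (by positivity)).1 h

theorem one_le_of_scaling (H : History T (t + 1)) {i : T} (hi : 0 < B.σ₀ i) {c : ℝ}
    (h : (B.postVar H i)⁻¹ ≤ c * (B.postVar (t := t) (Fin.init H) i)⁻¹) : 1 ≤ c := by
  have h1 := B.one_add_mul_likPrec_le_of_scaling H hi h
  have h2 := B.likPrec_init_le H i
  have h3 := B.one_add_mul_likPrec_pos (t := t) (Fin.init H) i
  have h4 : 1 + B.σ₀ i ^ 2 * B.likPrec (t := t) (Fin.init H) i ≤
    1 + B.σ₀ i ^ 2 * B.likPrec H i := by gcongr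
  by_contra hc
  push Not at hc
  nlinarith

open scoped Classical in
-- Induction towards the root along the recursion of `margVar`; `P` is the product of the squared
-- slopes collected so far, hence at most `1`. The invariant is that `P` is dominated by the
-- precision gained at the current node in this round, with one factor of `c` for each level. It is
-- what makes the contribution of every ancestor an increment of its own log gain.
theorem mul_margVar_le (hB : B.Valid) {c : ℝ} (hc : 0 < c) (H : History T (t + 1))
    (hsc : ∀ i, (B.postVar H i)⁻¹ ≤ c * (B.postVar (t := t) (Fin.init H) i)⁻¹) (k : T) {P : ℝ}
    (hP : 0 ≤ P) (hP1 : P ≤ 1) (hPC : P ≤ c ^ nodeHeight k * B.σ ^ 2 *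
      (B.likPrec H k - B.likPrec (t := t) (Fin.init H) k)) :
    P * B.margVar (t := t) (Fin.init H) k ≤ ∑ i with i ≤ k, c ^ nodeHeight i *
      (B.weightCoeff i * (B.logGain H i - B.logGain (t := t) (Fin.init H) i)) := by
  have hnode : ∀ (k : T) (P : ℝ), 0 ≤ P → P ≤ 1 → P ≤ c ^ nodeHeight k * B.σ ^ 2 *
      (B.likPrec H k - B.likPrec (t := t) (Fin.init H) k) → 0 ≤ B.σ₀ k →
      P * B.postVar (t := t) (Fin.init H) k ≤ c ^ nodeHeight k *
        (B.weightCoeff k * (B.logGain H k - B.logGain (t := t) (Fin.init H) k)) := by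
    intro k P hP hP1 hPC hk
    -- A certain root has no variance, and its scaling condition carries no information.
    rcases hk.eq_or_lt with h0 | h0
    · have : B.postVar (t := t) (Fin.init H) k = 0 := by simp [postVar, ← h0]
      rw [this, mul_zero]
      exact mul_nonneg (by positivity) (mul_nonneg (B.weightCoeff_nonneg k)
        (sub_nonneg.2 (B.logGain_init_le H k)))
    · exact B.mul_postVar_le hB.noise_pos H h0 hP hP1
        (one_le_pow₀ (B.one_le_of_scaling H h0 (hsc k))) hPC
  induction k using WellFoundedLT.induction generalizing P with
  | ind k ih =>
    by_cases hk : k = ⊥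
    · subst hk
      rw [margVar_bot]
      have : ({i | i ≤ ⊥} : Finset T) = {⊥} := by ext; simp
      rw [this, Finset.sum_singleton]
      exact hnode ⊥ P hP hP1 hPC hB.root_nonneg
    · have hlt := pred_lt_of_ne_bot hk
      have h0 := hB.node_pos k hk
      have hc1 := B.one_le_of_scaling H h0 (hsc k)
      have hset : ({i | i ≤ k} : Finset T) =
          insert k ({i | i ≤ Order.pred k} : Finset T) := by
        ext i
        simp only [Finset.mem_filter, Finset.mem_univ, true_and, Finset.mem_insert]
        constructor
        · intro h
          exact h.eq_or_lt.imp id Order.le_pred_of_lt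
        · rintro (rfl | h)
          · exact le_rfl
          · exact h.trans hlt.le
      rw [hset, Finset.sum_insert (by simp [hlt.not_ge]), margVar_of_ne_bot _ _ hk, mul_add,
        add_comm, ← mul_assoc]
      refine add_le_add (hnode k P hP hP1 hPC h0.le) ?_
      have hD := B.one_add_mul_likPrec_pos (t := t) (Fin.init H) k
      have hD' := B.one_add_mul_likPrec_pos H k
      have hM := B.likPrec_nonneg (t := t) (Fin.init H) k
      have hsl0 : 0 ≤ B.postSlope (t := t) (Fin.init H) k := by
        unfold postSlope; positivity
      have hsl1 : B.postSlope (t := t) (Fin.init H) k ≤ 1 := by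
        unfold postSlope
        rw [div_le_one hD]
        have : 0 ≤ B.σ₀ k ^ 2 * B.likPrec (t := t) (Fin.init H) k := by positivity
        linarith
      -- Pass to the parent with the weight `P` multiplied by the squared slope at `k`.
      refine ih _ hlt (by positivity) ?_ ?_
      · calc P * B.postSlope (t := t) (Fin.init H) k ^ 2 ≤ 1 * 1 ^ 2 := by gcongr
          _ = 1 := by norm_num
      · have hdM := B.likPrec_init_le H k
        have hscale := B.one_add_mul_likPrec_le_of_scaling H h0 (hsc k)
        have hcov : k ∈ children (Order.pred k) :=
          mem_children.2 (covBy_iff_eq_pred.2 ⟨hk, rfl⟩)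
        have hgain : B.msgPrec H k - B.msgPrec (t := t) (Fin.init H) k ≤
            B.likPrec H (Order.pred k) - B.likPrec (t := t) (Fin.init H) (Order.pred k) := by
          have hnm : ¬ IsMax (Order.pred k) := hlt.not_isMax
          rw [likPrec_of_not_isMax _ _ hnm, likPrec_of_not_isMax _ _ hnm,
            ← Finset.sum_sub_distrib]
          exact Finset.single_le_sum (f := fun j => B.msgPrec H j -
            B.msgPrec (t := t) (Fin.init H) j)
            (fun j _ => sub_nonneg.2 (B.msgPrec_init_le H j)) hcov
        rw [msgPrec_sub_msgPrec_init] at hgain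
        -- The parent may be higher than `k` by more than one level; `c ≥ 1` makes the larger power
        -- harmless.
        have hpow : c ^ (nodeHeight k + 1) ≤ c ^ nodeHeight (Order.pred k) :=
          pow_le_pow_right₀ hc1 (nodeHeight_lt_of_lt hlt)
        -- With `D`, `D'` the values of `1 + σ₀² M` before and after the round, the squared slope is
        -- `1 / D²` while the message gain carries `1 / (D D')`. The scaling condition `D' ≤ c D`
        -- bridges the two.
        have hdiv : B.postSlope (t := t) (Fin.init H) k ^ 2 *
            (B.likPrec H k - B.likPrec (t := t) (Fin.init H) k) ≤
            c * (B.likPrec H (Order.pred k) - B.likPrec (t := t) (Fin.init H) (Order.pred k)) := by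
          refine le_trans ?_ (mul_le_mul_of_nonneg_left hgain hc.le)
          unfold postSlope
          rw [div_pow, one_pow, one_div_mul_eq_div, ← mul_div_assoc,
            div_le_div_iff₀ (by positivity) (by positivity)]
          calc _ = (B.likPrec H k - B.likPrec (t := t) (Fin.init H) k) *
                (1 + B.σ₀ k ^ 2 * B.likPrec (t := t) (Fin.init H) k) *
                (1 + B.σ₀ k ^ 2 * B.likPrec H k) := by ring
            _ ≤ (B.likPrec H k - B.likPrec (t := t) (Fin.init H) k) *
                (1 + B.σ₀ k ^ 2 * B.likPrec (t := t) (Fin.init H) k) *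
                (c * (1 + B.σ₀ k ^ 2 * B.likPrec (t := t) (Fin.init H) k)) := by
              have := sub_nonneg.2 hdM
              gcongr
            _ = _ := by ring
        calc P * B.postSlope (t := t) (Fin.init H) k ^ 2 ≤ c ^ nodeHeight k * B.σ ^ 2 *
              (B.likPrec H k - B.likPrec (t := t) (Fin.init H) k) *
              B.postSlope (t := t) (Fin.init H) k ^ 2 := by gcongr
          _ = c ^ nodeHeight k * B.σ ^ 2 * (B.postSlope (t := t) (Fin.init H) k ^ 2 *
              (B.likPrec H k - B.likPrec (t := t) (Fin.init H) k)) := by ring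
          _ ≤ c ^ nodeHeight k * B.σ ^ 2 * (c * (B.likPrec H (Order.pred k) -
              B.likPrec (t := t) (Fin.init H) (Order.pred k))) := by gcongr
          _ = c ^ (nodeHeight k + 1) * (B.σ ^ 2 * (B.likPrec H (Order.pred k) -
              B.likPrec (t := t) (Fin.init H) (Order.pred k))) := by ring
          _ ≤ c ^ nodeHeight (Order.pred k) * (B.σ ^ 2 * (B.likPrec H (Order.pred k) -
              B.likPrec (t := t) (Fin.init H) (Order.pred k))) := by
            have := sub_nonneg.2 (B.likPrec_init_le H (Order.pred k))
            gcongr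
          _ = _ := by ring

theorem margVar_le_sum_logGain (hB : B.Valid) {c : ℝ} (hc : 0 < c) (H : History T (t + 1))
    (hsc : ∀ i, (B.postVar H i)⁻¹ ≤ c * (B.postVar (t := t) (Fin.init H) i)⁻¹) :
    B.margVar (t := t) (Fin.init H) (H (Fin.last t)).1 ≤ ∑ i, c ^ nodeHeight i *
      (B.weightCoeff i * (B.logGain H i - B.logGain (t := t) (Fin.init H) i)) := by
  classical
  set a := (H (Fin.last t)).1 with ha
  have hσ := hB.noise_pos
  -- The invariant starts with `P = 1`: the action taken has height `0` and gains precision exactly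
  -- `1 / σ²`, so it holds with equality.
  have h := B.mul_margVar_le hB hc H hsc a zero_le_one le_rfl (by
    rw [nodeHeight_of_isMax a.2, likPrec_of_isMax _ _ a.2, likPrec_of_isMax _ _ a.2,
      card_rounds_succ, if_pos rfl]
    push_cast
    apply le_of_eq
    field_simp
    ring)
  rw [one_mul] at h
  refine h.trans (Finset.sum_le_sum_of_subset_of_nonneg (Finset.subset_univ _) fun i _ _ => ?_)
  exact mul_nonneg (by positivity) (mul_nonneg (B.weightCoeff_nonneg i)
    (sub_nonneg.2 (B.logGain_init_le H i)))

/-- The sum over the rounds of the posterior variances of the actions taken. -/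
noncomputable def sumVar : (t : ℕ) → History T t → ℝ
  | 0, _ => 0
  | t + 1, H => sumVar t (Fin.init H) + B.margVar (t := t) (Fin.init H) (H (Fin.last t)).1

/-- The sum over the rounds of the posterior standard deviations of the actions taken. -/
noncomputable def sumWidth : (t : ℕ) → History T t → ℝ
  | 0, _ => 0
  | t + 1, H => sumWidth t (Fin.init H) + √(B.margVar (t := t) (Fin.init H) (H (Fin.last t)).1)

theorem sumWidth_nonneg (H : History T t) : 0 ≤ B.sumWidth t H := by
  induction t with
  | zero => exact le_rfl
  | succ t ih => exact add_nonneg (ih _) (Real.sqrt_nonneg _)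

/-- Cauchy–Schwarz over the rounds, done inductively with the weighted inequality `2 S w ≤ S² / t +
t w²`. -/
theorem sumWidth_sq_le (H : History T t) : B.sumWidth t H ^ 2 ≤ t * B.sumVar t H := by
  induction t with
  | zero => simp [sumWidth, sumVar]
  | succ t ih =>
    have h := ih (Fin.init H)
    rw [sumWidth, sumVar]
    set w := √(B.margVar (t := t) (Fin.init H) (H (Fin.last t)).1) with hw
    have hw2 : B.margVar (t := t) (Fin.init H) (H (Fin.last t)).1 = w ^ 2 :=
      (Real.sq_sqrt (B.margVar_nonneg _ _)).symm
    rw [hw2]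
    set S := B.sumWidth t (Fin.init H)
    set V := B.sumVar t (Fin.init H)
    rcases Nat.eq_zero_or_pos t with h0 | h0
    · subst h0
      have hS : S = 0 := rfl
      have hV : V = 0 := rfl
      rw [hS, hV]
      simp
    · have ht : (0 : ℝ) < t := by exact_mod_cast h0
      have h1 : 2 * S * w ≤ S ^ 2 / t + t * w ^ 2 := by
        have : S ^ 2 / t + t * w ^ 2 - 2 * S * w = (S - t * w) ^ 2 / t := by field_simp; ring
        have h2 : 0 ≤ (S - t * w) ^ 2 / t := by positivity
        linarith
      have h2 : S ^ 2 / t ≤ V := by rw [div_le_iff₀ ht]; linarith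
      push_cast
      nlinarith

/-- The increments of the log gains telescope over the rounds. -/
theorem sumVar_le_sum_logGain (hB : B.Valid) {n : ℕ} {c : ℝ} (hc : 0 < c)
    (hsc : B.PosteriorScaling n c) (ht : t ≤ n) (H : History T t) :
    B.sumVar t H ≤ ∑ i, c ^ nodeHeight i * (B.weightCoeff i * B.logGain H i) := by
  induction t with
  | zero =>
    refine Finset.sum_nonneg fun i _ => mul_nonneg (by positivity)
      (mul_nonneg (B.weightCoeff_nonneg i) (Real.log_nonneg ?_))
    have := B.likPrec_nonneg H i
    have : 0 ≤ B.σ₀ i ^ 2 * B.likPrec H i := by positivity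
    linarith
  | succ t ih =>
    have h1 := ih (by omega) (Fin.init H)
    have h2 := B.margVar_le_sum_logGain hB hc H (hsc t (by omega) H)
    simp only [mul_sub, Finset.sum_sub_distrib] at h2
    rw [sumVar]
    linarith

/-- An action has at most `n` observations, while the message of a child `j` never has precision
above `σ₀_j⁻²`, however much is observed below it. This is why the weights of inner nodes do not
grow with `n`. -/
theorem sumVar_le_complexity (hB : B.Valid) {n : ℕ} {c : ℝ} (hc : 0 < c)
    (hsc : B.PosteriorScaling n c) (H : History T n) : B.sumVar n H ≤ B.complexity n c := by
  refine (B.sumVar_le_sum_logGain hB hc hsc le_rfl H).trans (Finset.sum_le_sum fun i _ => ?_)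
  have h0 := B.weightCoeff_nonneg i
  unfold weight
  refine mul_le_mul_of_nonneg_left (mul_le_mul_of_nonneg_left ?_ h0) (by positivity)
  have hσ := hB.noise_pos
  split_ifs with hi
  · refine Real.log_le_log (B.one_add_mul_likPrec_pos H i) ?_
    rw [likPrec_of_isMax _ _ hi, mul_div_assoc]
    gcongr
    exact (Finset.card_le_univ _).trans_eq (Fintype.card_fin n)
  · refine Real.log_le_log (B.one_add_mul_likPrec_pos H i) ?_
    rw [likPrec_of_not_isMax _ _ hi]
    gcongr with j hj
    have hj0 := hB.node_pos j fun h => (h ▸ lt_of_mem_children hj).not_ge bot_le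
    have hM := B.likPrec_nonneg H j
    rw [msgPrec, div_le_iff₀ (B.one_add_mul_likPrec_pos H j), mul_add,
      inv_mul_cancel_left₀ (by positivity)]
    have : 0 ≤ (B.σ₀ j ^ 2)⁻¹ * 1 := by positivity
    linarith

end TreeBandit

/-! ### Expected Gaussian excess over a confidence width -/

theorem lintegral_ofReal_gaussianReal_le :
    ∫⁻ x, ENNReal.ofReal x ∂gaussianReal 0 1 ≤ ENNReal.ofReal (1 / 2) := by
  have h2 : Integrable (fun x : ℝ => x ^ 2) (gaussianReal 0 1) :=
    (memLp_id_gaussianReal (μ := 0) (v := 1) 2).integrable_sq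
  have h1 : Integrable (fun x : ℝ => x) (gaussianReal 0 1) :=
    (memLp_id_gaussianReal (μ := 0) (v := 1) 1).integrable le_rfl
  have hvar : ∫ x, x ^ 2 ∂gaussianReal 0 1 = 1 := by
    have h := variance_of_integral_eq_zero (X := fun x : ℝ => x) (μ := gaussianReal 0 1)
      aemeasurable_id' integral_id_gaussianReal
    rw [variance_fun_id_gaussianReal] at h
    simpa using h.symm
  -- The positive part of `x` lies below `(x + 1)² / 4`, which has mean `1/2`. The exact value is
  -- not needed, since the final constant `√(2/π)` leaves room.
  calc ∫⁻ x, ENNReal.ofReal x ∂gaussianReal 0 1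
      ≤ ∫⁻ x, ENNReal.ofReal ((1 / 4 : ℝ) + (1 / 2 * x + 1 / 4 * x ^ 2)) ∂gaussianReal 0 1 :=
        lintegral_mono fun x => ENNReal.ofReal_le_ofReal (by nlinarith [sq_nonneg (x - 1)])
    _ = ENNReal.ofReal (∫ x, ((1 / 4 : ℝ) + (1 / 2 * x + 1 / 4 * x ^ 2)) ∂gaussianReal 0 1) := by
        rw [ofReal_integral_eq_lintegral_ofReal]
        · exact (integrable_const _).add ((h1.const_mul _).add (h2.const_mul _))
        · exact Eventually.of_forall fun x => by
            simp only [Pi.zero_apply]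
            nlinarith [sq_nonneg (x + 1)]
    _ = ENNReal.ofReal (1 / 2) := by
        congr 1
        have h3 : Integrable (fun x : ℝ => 1 / 2 * x + 1 / 4 * x ^ 2) (gaussianReal 0 1) :=
          (h1.const_mul _).add (h2.const_mul _)
        rw [integral_add (integrable_const _) h3,
          integral_add (h1.const_mul _) (h2.const_mul _), integral_const_mul, integral_const_mul,
          integral_id_gaussianReal, hvar]
        norm_num

/-- After translation by `C`, the Gaussian density at `x + C` is at most `exp (-C²/2)` times that at
`x`, for `x ≥ 0`. -/
theorem lintegral_ofReal_sub_gaussianReal_le {C : ℝ} (hC : 0 ≤ C) :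
    ∫⁻ x, ENNReal.ofReal (x - C) ∂gaussianReal 0 1 ≤
      ENNReal.ofReal (Real.exp (-C ^ 2 / 2) / 2) := by
  rw [gaussianReal_of_var_ne_zero _ one_ne_zero,
    lintegral_withDensity_eq_lintegral_mul _ (by fun_prop) (by fun_prop),
    ← lintegral_add_right_eq_self _ C]
  calc _ ≤ ∫⁻ x, ENNReal.ofReal (Real.exp (-C ^ 2 / 2)) *
        (gaussianPDF 0 1 x * ENNReal.ofReal x) := by
        refine lintegral_mono fun x => ?_
        simp only [Pi.mul_apply, add_sub_cancel_right]
        rcases le_total x 0 with hx | hx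
        · simp [ENNReal.ofReal_of_nonpos hx]
        · rw [← mul_assoc]
          gcongr
          rw [gaussianPDF, gaussianPDF, ← ENNReal.ofReal_mul (Real.exp_nonneg _)]
          refine ENNReal.ofReal_le_ofReal ?_
          rw [gaussianPDFReal, gaussianPDFReal, mul_left_comm, ← Real.exp_add]
          gcongr
          simp only [NNReal.coe_one]
          nlinarith [mul_nonneg hx hC]
    _ = ENNReal.ofReal (Real.exp (-C ^ 2 / 2)) *
        ∫⁻ x, ENNReal.ofReal x ∂gaussianReal 0 1 := by
        rw [lintegral_const_mul _ (by fun_prop), gaussianReal_of_var_ne_zero _ one_ne_zero,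
          lintegral_withDensity_eq_lintegral_mul _ (by fun_prop) (by fun_prop)]
        rfl
    _ ≤ ENNReal.ofReal (Real.exp (-C ^ 2 / 2)) * ENNReal.ofReal (1 / 2) := by
        gcongr
        exact lintegral_ofReal_gaussianReal_le
    _ = _ := by rw [← ENNReal.ofReal_mul (Real.exp_nonneg _), mul_one_div]

theorem lintegral_ofReal_sub_sub_gaussianReal_le (m : ℝ) {v C : ℝ} (hv : 0 ≤ v) (hC : 0 ≤ C) :
    ∫⁻ x, ENNReal.ofReal (x - m - C * √v) ∂gaussianReal m v.toNNReal ≤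
      ENNReal.ofReal (√v * (Real.exp (-C ^ 2 / 2) / 2)) := by
  have hmap : (gaussianReal 0 1).map (fun x => m + √v * x) = gaussianReal m v.toNNReal := by
    rw [← Function.comp_def (fun x => m + x) (fun x => √v * x),
      ← Measure.map_map (by fun_prop) (by fun_prop),
      gaussianReal_map_const_mul, gaussianReal_map_const_add]
    congr 1
    · simp
    · ext; simp [hv, Real.sq_sqrt]
  rw [← hmap, lintegral_map (by fun_prop) (by fun_prop)]
  have h : ∀ x, ENNReal.ofReal (m + √v * x - m - C * √v) =
      ENNReal.ofReal √v * ENNReal.ofReal (x - C) := fun x => by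
    rw [← ENNReal.ofReal_mul (Real.sqrt_nonneg _)]
    congr 1
    ring
  simp_rw [h]
  rw [lintegral_const_mul _ (by fun_prop), ENNReal.ofReal_mul (Real.sqrt_nonneg _)]
  gcongr
  exact lintegral_ofReal_sub_gaussianReal_le hC

theorem ofReal_integral_le_lintegral_ofReal {X : Type*} [MeasurableSpace X] {μ : Measure X}
    {f : X → ℝ} (hf : Integrable f μ) :
    ENNReal.ofReal (∫ x, f x ∂μ) ≤ ∫⁻ x, ENNReal.ofReal (f x) ∂μ := by
  rw [integral_eq_lintegral_pos_part_sub_lintegral_neg_part hf]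
  exact (ENNReal.ofReal_le_ofReal (sub_le_self _ ENNReal.toReal_nonneg)).trans
    ENNReal.ofReal_toReal_le

theorem exp_neg_sq_sqrt_log_le {δ : ℝ} (hδ : 0 < δ) :
    Real.exp (-√(2 * Real.log (1 / δ)) ^ 2 / 2) ≤ δ := by
  rcases le_total δ 1 with h | h
  · have : 0 ≤ Real.log (1 / δ) := Real.log_nonneg (by rw [le_div_iff₀ hδ]; linarith)
    rw [Real.sq_sqrt (by positivity), neg_div, mul_div_cancel_left₀ _ two_ne_zero, one_div,
      Real.log_inv, neg_neg, Real.exp_log hδ]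
  -- For `δ ≥ 1` the square root takes its default value `0`, and the claim becomes `1 ≤ δ`.
  · have : Real.log (1 / δ) ≤ 0 := Real.log_nonpos (by positivity) (by rw [div_le_one hδ]; exact h)
    rw [Real.sqrt_eq_zero_of_nonpos (by linarith)]
    simpa using h

/-! ### One round of Thompson sampling -/

section ThompsonRound

variable {T : RootedTree.{u}} [Fintype T] {sel : (T → ℝ) → Leaf T}

theorem measurable_eval_sel (hsel : Measurable sel) : Measurable fun θ : T → ℝ => θ (sel θ) :=
  measurable_eval_leaf.comp (measurable_id.prodMk hsel)

theorem integrable_eval_sel {X : Type*} [MeasurableSpace X] {μ : Measure X} {f : X → T → ℝ}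
    {a : X → Leaf T} (hf : ∀ i, Integrable (fun x => f x i) μ) (hfm : Measurable f)
    (ha : Measurable a) : Integrable (fun x => f x (a x)) μ := by
  refine (integrable_finsetSum Finset.univ fun i _ => (hf i).norm).mono'
    (measurable_eval_leaf.comp (hfm.prodMk ha)).aestronglyMeasurable
    (Eventually.of_forall fun x => ?_)
  exact Finset.single_le_sum (f := fun i => ‖f x i‖) (fun i _ => norm_nonneg _)
    (Finset.mem_univ ((a x : T)))

/-- The expected regret of a round of Thompson sampling, if the model parameters and the sample are
independent with the same law, whose marginals are Gaussian. -/
theorem lintegral_round_regret_le (hsel : TreeBandit.IsArgmax sel) (Q : Measure (T → ℝ))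
    [IsProbabilityMeasure Q] {m v : T → ℝ} (hv : ∀ i, 0 ≤ v i)
    (hQ : ∀ i, Q.map (fun θ => θ i) = gaussianReal (m i) (v i).toNNReal) {V δ : ℝ}
    (hV : ∀ a : Leaf T, √(v a) ≤ V) (hδ : 0 < δ) :
    ∫⁻ θ, ∫⁻ s, ENNReal.ofReal (θ (sel θ) - θ (sel s)) ∂Q ∂Q ≤
      ∫⁻ s, ENNReal.ofReal (√(2 * Real.log (1 / δ)) * √(v (sel s))) ∂Q +
        ENNReal.ofReal (Nat.card (Leaf T) * (V * (δ / 2))) := by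
  classical
  have := Fintype.ofFinite (Leaf T)
  have hm := hsel.measurable
  set C := √(2 * Real.log (1 / δ)) with hC
  have hint : ∀ i, Integrable (fun θ : T → ℝ => θ i) Q := fun i => by
    have h : Integrable (fun x : ℝ => x) (Q.map fun θ => θ i) := by
      rw [hQ]
      exact (memLp_id_gaussianReal 1).integrable le_rfl
    exact (integrable_map_measure (f := fun θ : T → ℝ => θ i) (g := fun x : ℝ => x)
      (by fun_prop) (measurable_pi_apply i).aemeasurable).1 h
  have hmean : ∀ i, ∫ θ, θ i ∂Q = m i := fun i => by
    have h := integral_map (μ := Q) (φ := fun θ : T → ℝ => θ i) (f := fun x : ℝ => x)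
      (measurable_pi_apply i).aemeasurable (by fun_prop)
    rw [← h, hQ, integral_id_gaussianReal]
  have hI1 : Integrable (fun p : (T → ℝ) × (T → ℝ) => p.1 (sel p.1)) (Q.prod Q) :=
    integrable_eval_sel (f := fun p : (T → ℝ) × (T → ℝ) => p.1) (fun i => (hint i).comp_fst Q)
      measurable_fst (hm.comp measurable_fst)
  have hI2 : Integrable (fun p : (T → ℝ) × (T → ℝ) => p.1 (sel p.2)) (Q.prod Q) :=
    integrable_eval_sel (f := fun p : (T → ℝ) × (T → ℝ) => p.1) (fun i => (hint i).comp_fst Q)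
      measurable_fst (hm.comp measurable_snd)
  have hI3 : Integrable (fun θ : T → ℝ => θ (sel θ)) Q :=
    integrable_eval_sel (f := fun θ => θ) hint measurable_id hm
  have hI4 : Integrable (fun θ : T → ℝ => m (sel θ)) Q :=
    integrable_eval_sel (f := fun _ => m) (fun i => integrable_const _) measurable_const hm
  -- By independence the mean of `θ (sel s)` is that of `m (sel s)`, and since `s` and `θ` have the
  -- same law, this is the mean of `m (sel θ)`.
  have e1 : ∫⁻ θ, ∫⁻ s, ENNReal.ofReal (θ (sel θ) - θ (sel s)) ∂Q ∂Q =
      ENNReal.ofReal (∫ θ, (θ (sel θ) - m (sel θ)) ∂Q) := by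
    have hmeas : Measurable fun p : (T → ℝ) × (T → ℝ) => p.1 (sel p.1) - p.1 (sel p.2) :=
      ((measurable_eval_sel hm).comp measurable_fst).sub
        (measurable_eval_leaf.comp (measurable_fst.prodMk (hm.comp measurable_snd)))
    have hI12 : Integrable (fun p : (T → ℝ) × (T → ℝ) => p.1 (sel p.1) - p.1 (sel p.2))
      (Q.prod Q) := hI1.sub hI2
    rw [← lintegral_prod (fun p : (T → ℝ) × (T → ℝ) =>
        ENNReal.ofReal (p.1 (sel p.1) - p.1 (sel p.2))) hmeas.ennreal_ofReal.aemeasurable,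
      ← ofReal_integral_eq_lintegral_ofReal hI12
        (Eventually.of_forall fun p => sub_nonneg.2 (hsel.le_sel _ _)),
      integral_sub hI1 hI2, integral_sub hI3 hI4, integral_prod _ hI1, integral_prod_symm _ hI2]
    simp only [integral_const, probReal_univ, one_smul, hmean]
  -- The excess beyond the confidence width at the random optimal arm is bounded by the sum of the
  -- positive excesses of all arms; this gives the factor `K`.
  have e2 : ∀ θ : T → ℝ, ENNReal.ofReal (θ (sel θ) - m (sel θ)) ≤
      ENNReal.ofReal (C * √(v (sel θ))) +
        ∑ a : Leaf T, ENNReal.ofReal (θ a - m a - C * √(v a)) := fun θ => by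
    calc ENNReal.ofReal (θ (sel θ) - m (sel θ))
        = ENNReal.ofReal (C * √(v (sel θ)) + (θ (sel θ) - m (sel θ) - C * √(v (sel θ)))) := by
          congr 1; ring
      _ ≤ _ := ENNReal.ofReal_add_le
      _ ≤ _ := by
        gcongr
        exact Finset.single_le_sum (f := fun a : Leaf T =>
          ENNReal.ofReal (θ a - m a - C * √(v a))) (fun _ _ => zero_le) (Finset.mem_univ (sel θ))
  have e3 : ∀ a : Leaf T, ∫⁻ θ, ENNReal.ofReal (θ a - m a - C * √(v a)) ∂Q ≤
      ENNReal.ofReal (V * (δ / 2)) := fun a => by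
    have h := lintegral_map (μ := Q) (f := fun x => ENNReal.ofReal (x - m a - C * √(v a)))
      (g := fun θ : T → ℝ => θ a) (by fun_prop) (by fun_prop)
    rw [← h, hQ]
    refine (lintegral_ofReal_sub_sub_gaussianReal_le (m a) (hv a) (Real.sqrt_nonneg _)).trans
      (ENNReal.ofReal_le_ofReal ?_)
    have hV0 := (Real.sqrt_nonneg _).trans (hV a)
    have hexp := exp_neg_sq_sqrt_log_le hδ
    gcongr
    exact hV a
  have hm1 : Measurable fun θ : T → ℝ => ENNReal.ofReal (C * √(v (sel θ))) :=
    ((measurable_of_countable fun a : Leaf T => C * √(v a)).comp hm).ennreal_ofReal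
  rw [e1]
  calc _ ≤ ∫⁻ θ, ENNReal.ofReal (θ (sel θ) - m (sel θ)) ∂Q :=
        ofReal_integral_le_lintegral_ofReal (hI3.sub hI4)
    _ ≤ _ := lintegral_mono e2
    _ = ∫⁻ θ, ENNReal.ofReal (C * √(v (sel θ))) ∂Q +
        ∑ a : Leaf T, ∫⁻ θ, ENNReal.ofReal (θ a - m a - C * √(v a)) ∂Q := by
      rw [lintegral_add_left hm1, lintegral_finsetSum _ fun a _ => by fun_prop]
    _ ≤ ∫⁻ θ, ENNReal.ofReal (C * √(v (sel θ))) ∂Q +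
        ∑ a : Leaf T, ENNReal.ofReal (V * (δ / 2)) := by
      gcongr with a
      exact e3 a
    _ = _ := by
      rw [Finset.sum_const, Finset.card_univ, nsmul_eq_mul, Nat.card_eq_fintype_card,
        ENNReal.ofReal_mul (Nat.cast_nonneg _), ENNReal.ofReal_natCast]

end ThompsonRound

theorem measurable_leaf_family {T : RootedTree.{u}} [Fintype T] {X Y : Type*} [MeasurableSpace X]
    [MeasurableSpace Y] {g : T → Y → ℝ} (hg : ∀ i, Measurable (g i)) {f : X → Y}
    (hf : Measurable f) {a : X → Leaf T} (ha : Measurable a) :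
    Measurable fun x => g (a x) (f x) := by
  have h : Measurable fun p : Y × Leaf T => g p.2 p.1 :=
    measurable_from_prod_countable_left fun i => hg (i : T)
  exact h.comp (hf.prodMk ha)

/-! ### The regret bound over `n` rounds -/

namespace TreeBandit

variable {T : RootedTree.{u}}

theorem Valid.nonneg {B : TreeBandit T} [Fintype T] (hB : B.Valid) (i : T) : 0 ≤ B.σ₀ i := by
  by_cases hi : i = ⊥
  · rw [hi]; exact hB.root_nonneg
  · exact (hB.node_pos i hi).le

variable {t : ℕ} {sel : (T → ℝ) → Leaf T}

theorem measurable_init {t : ℕ} :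
    Measurable fun H : History T (t + 1) => (Fin.init H : History T t) :=
  measurable_pi_iff.2 fun l => measurable_pi_apply l.castSucc

variable [Fintype T]

theorem iSup_eq_sel (hsel : IsArgmax sel) (θ : T → ℝ) : ⨆ a : Leaf T, θ a = θ (sel θ) :=
  have : Nonempty (Leaf T) := ⟨sel θ⟩
  le_antisymm (ciSup_le (hsel.le_sel θ))
    (le_ciSup (f := fun a : Leaf T => θ a) (Set.finite_range _).bddAbove (sel θ))

theorem regret_nonneg (hsel : IsArgmax sel) (x : (T → ℝ) × History T t) : 0 ≤ regret x :=
  Finset.sum_nonneg fun l _ => by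
    rw [iSup_eq_sel hsel]
    exact sub_nonneg.2 (hsel.le_sel _ _)

theorem measurable_regret (hsel : IsArgmax sel) :
    Measurable (regret : (T → ℝ) × History T t → ℝ) := by
  unfold regret
  simp_rw [iSup_eq_sel hsel]
  refine Finset.measurable_sum _ fun l _ => ?_
  refine ((measurable_eval_sel hsel.measurable).comp measurable_fst).sub ?_
  exact measurable_eval_leaf.comp (Measurable.prodMk (by fun_prop) (by fun_prop))

theorem regret_snoc (hsel : IsArgmax sel) (θ : T → ℝ) (H : History T t) (z : Leaf T × ℝ) :
    regret (θ, (Fin.snoc (α := fun _ => Leaf T × ℝ) H z : History T (t + 1))) =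
      regret (θ, H) + (θ (sel θ) - θ z.1) := by
  rw [regret, Fin.sum_univ_castSucc]
  simp only [Fin.snoc_castSucc, Fin.snoc_last, iSup_eq_sel hsel, regret]

variable (B : TreeBandit T)

theorem measurable_margVar (i : T) : Measurable fun H : History T t => B.margVar H i := by
  induction i using WellFoundedLT.induction with
  | ind i ih =>
    by_cases hi : i = ⊥
    · simp_rw [hi, margVar_bot]
      exact B.measurable_postVar ⊥
    · simp_rw [margVar_of_ne_bot _ _ hi]
      have h1 := ih _ (pred_lt_of_ne_bot hi)
      have h2 := B.measurable_postVar (t := t) i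
      have h3 := B.measurable_likPrec (t := t) i
      unfold postSlope
      fun_prop

theorem measurable_sumWidth (t : ℕ) : Measurable (B.sumWidth t) := by
  induction t with
  | zero => exact measurable_const
  | succ t ih =>
    change Measurable fun H : History T (t + 1) => B.sumWidth t (Fin.init H) +
      √(B.margVar (t := t) (Fin.init H) (H (Fin.last t)).1)
    refine (ih.comp measurable_init).add (Measurable.sqrt ?_)
    have h1 : Measurable fun H : History T (t + 1) => (H (Fin.last t)).1 :=
      (measurable_pi_apply (Fin.last t)).fst
    exact measurable_leaf_family (g := fun i (H : History T t) => B.margVar H i)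
      B.measurable_margVar measurable_init h1

theorem sumWidth_snoc (H : History T t) (z : Leaf T × ℝ) :
    B.sumWidth (t + 1) (Fin.snoc (α := fun _ => Leaf T × ℝ) H z) =
      B.sumWidth t H + √(B.margVar H z.1) := by
  rw [sumWidth]
  simp only [Fin.init_snoc, Fin.snoc_last]

theorem map_sampleLaw_eval (H : History T t) (i : T) :
    (B.sampleLaw H).map (fun θ => θ i) =
      gaussianReal (treeEval (B.postMean H) 0 B.μ 0 i) (B.margVar H i).toNNReal := by
  refine map_treeLaw_eval (α := B.postSlope H) (β := fun i => B.σ₀ i ^ 2 *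
    (B.likPrec H i * B.msgMean H i) / (1 + B.σ₀ i ^ 2 * B.likPrec H i)) (fun i p => ?_) i
  rw [postMean, postSlope]
  ring

open scoped Classical in
theorem margVar_le_sum (H : History T t) (i : T) :
    B.margVar H i ≤ ∑ j with j ≤ i, B.σ₀ j ^ 2 := by
  have hpost : ∀ j, B.postVar H j ≤ B.σ₀ j ^ 2 := fun j => by
    have h := mul_nonneg (sq_nonneg (B.σ₀ j)) (B.likPrec_nonneg H j)
    exact div_le_self (sq_nonneg _) (by linarith)
  induction i using WellFoundedLT.induction with
  | ind i ih =>
    by_cases hi : i = ⊥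
    · subst hi
      have : ({j | j ≤ ⊥} : Finset T) = {⊥} := by ext; simp
      rw [margVar_bot, this, Finset.sum_singleton]
      exact hpost ⊥
    · have hlt := pred_lt_of_ne_bot hi
      have hset : ({j | j ≤ i} : Finset T) =
          insert i ({j | j ≤ Order.pred i} : Finset T) := by
        ext j
        simp only [Finset.mem_filter, Finset.mem_univ, true_and, Finset.mem_insert]
        constructor
        · intro h
          exact h.eq_or_lt.imp id Order.le_pred_of_lt
        · rintro (rfl | h)
          · exact le_rfl
          · exact h.trans hlt.le
      rw [margVar_of_ne_bot _ _ hi, hset, Finset.sum_insert (by simp [hlt.not_ge]), add_comm]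
      refine add_le_add (hpost i) (le_trans ?_ (ih _ hlt))
      have h := mul_nonneg (sq_nonneg (B.σ₀ i)) (B.likPrec_nonneg H i)
      have hs : B.postSlope H i ^ 2 ≤ 1 := by
        unfold postSlope
        refine pow_le_one₀ (by positivity) ?_
        rw [div_le_one (by linarith)]
        linarith
      exact mul_le_of_le_one_left (B.margVar_nonneg H _) hs

theorem sqrt_margVar_le_sigmaMax (H : History T t) (a : Leaf T) :
    √(B.margVar H a) ≤ B.sigmaMax := by
  classical
  refine (Real.sqrt_le_sqrt (B.margVar_le_sum H a)).trans ?_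
  exact le_ciSup (f := fun a : Leaf T =>
    √(∑ j ∈ Finset.univ.filter (fun j : T => j ≤ a), B.σ₀ j ^ 2))
    (Set.finite_range _).bddAbove a

theorem sigmaMax_nonneg : 0 ≤ B.sigmaMax := Real.iSup_nonneg fun _ => Real.sqrt_nonneg _

attribute [local instance] isProbabilityMeasure_sampleLaw isProbabilityMeasure_prior

/-- Replacing the true parameters by a posterior draw makes them i.i.d. with the sample given the
history, which is the situation of `lintegral_round_regret_le`. -/
theorem lintegral_round_le (hB : B.Valid) (hsel : IsArgmax sel) {δ : ℝ} (hδ : 0 < δ) (t : ℕ) :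
    ∫⁻ x, ∫⁻ s, ENNReal.ofReal (x.1 (sel x.1) - x.1 (sel s)) ∂B.sampleLaw x.2 ∂B.runLaw sel t ≤
      ∫⁻ x, ∫⁻ s, ENNReal.ofReal (√(2 * Real.log (1 / δ)) * √(B.margVar x.2 (sel s)))
        ∂B.sampleLaw x.2 ∂B.runLaw sel t +
        ENNReal.ofReal (Nat.card (Leaf T) * (B.sigmaMax * (δ / 2))) := by
  have hm := hsel.measurable
  have := B.isProbabilityMeasure_runLaw hm t
  have h1 : Measurable fun q : ((T → ℝ) × History T t) × (T → ℝ) =>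
      q.1.1 (sel q.1.1) - q.1.1 (sel q.2) :=
    ((measurable_eval_sel hm).comp (measurable_fst.comp measurable_fst)).sub
      (measurable_eval_leaf.comp ((measurable_fst.comp measurable_fst).prodMk
        (hm.comp measurable_snd)))
  have hf : Measurable fun x : (T → ℝ) × History T t =>
      ∫⁻ s, ENNReal.ofReal (x.1 (sel x.1) - x.1 (sel s)) ∂B.sampleLaw x.2 :=
    measurable_lintegral_of_measurable (κ := fun x : (T → ℝ) × History T t => B.sampleLaw x.2)
      (B.measurable_sampleLaw.comp measurable_snd)
      (f := fun x s => ENNReal.ofReal (x.1 (sel x.1) - x.1 (sel s))) h1.ennreal_ofReal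
  rw [B.lintegral_runLaw_eq_sampleLaw hB hm hf]
  calc _ ≤ ∫⁻ x, (∫⁻ s, ENNReal.ofReal (√(2 * Real.log (1 / δ)) * √(B.margVar x.2 (sel s)))
        ∂B.sampleLaw x.2 + ENNReal.ofReal (Nat.card (Leaf T) * (B.sigmaMax * (δ / 2))))
        ∂B.runLaw sel t := lintegral_mono fun x =>
          lintegral_round_regret_le hsel (B.sampleLaw x.2) (B.margVar_nonneg x.2)
            (B.map_sampleLaw_eval x.2) (B.sqrt_margVar_le_sigmaMax x.2) hδ
    _ = _ := by
      rw [lintegral_add_right _ measurable_const, lintegral_const, measure_univ, mul_one]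

theorem lintegral_regret_le (hB : B.Valid) (hsel : IsArgmax sel) {δ : ℝ} (hδ : 0 < δ) (n : ℕ) :
    ∫⁻ x, ENNReal.ofReal (regret x) ∂B.runLaw sel n ≤
      ∫⁻ x, ENNReal.ofReal (√(2 * Real.log (1 / δ)) * B.sumWidth n x.2) ∂B.runLaw sel n +
        n * ENNReal.ofReal (Nat.card (Leaf T) * (B.sigmaMax * (δ / 2))) := by
  have hm := hsel.measurable
  set C := √(2 * Real.log (1 / δ)) with hC
  induction n with
  | zero => simp [regret]
  | succ n ih =>
    have hr := measurable_regret (t := n) hsel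
    have e1 : ∫⁻ x, ENNReal.ofReal (regret x) ∂B.runLaw sel (n + 1) =
        ∫⁻ x, ENNReal.ofReal (regret x) ∂B.runLaw sel n +
          ∫⁻ x, ∫⁻ s, ENNReal.ofReal (x.1 (sel x.1) - x.1 (sel s))
            ∂B.sampleLaw x.2 ∂B.runLaw sel n := by
      rw [B.lintegral_runLaw_succ hm (measurable_regret hsel).ennreal_ofReal,
        ← lintegral_add_left hr.ennreal_ofReal]
      refine lintegral_congr fun x => ?_
      simp_rw [regret_snoc hsel, lintegral_const, measure_univ, mul_one]
      have h : ∀ s, ENNReal.ofReal (regret x + (x.1 (sel x.1) - x.1 (sel s))) =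
          ENNReal.ofReal (regret x) + ENNReal.ofReal (x.1 (sel x.1) - x.1 (sel s)) := fun s =>
        ENNReal.ofReal_add (regret_nonneg hsel x) (sub_nonneg.2 (hsel.le_sel _ _))
      simp_rw [h]
      rw [lintegral_add_left measurable_const, lintegral_const, measure_univ, mul_one]
    have e2 : ∫⁻ x, ENNReal.ofReal (C * B.sumWidth (n + 1) x.2) ∂B.runLaw sel (n + 1) =
        ∫⁻ x, ENNReal.ofReal (C * B.sumWidth n x.2) ∂B.runLaw sel n +
          ∫⁻ x, ∫⁻ s, ENNReal.ofReal (C * √(B.margVar x.2 (sel s)))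
            ∂B.sampleLaw x.2 ∂B.runLaw sel n := by
      have hC0 : 0 ≤ C := Real.sqrt_nonneg _
      have hms : ∀ k, Measurable fun x : (T → ℝ) × History T k =>
          ENNReal.ofReal (C * B.sumWidth k x.2) := fun k =>
        (((B.measurable_sumWidth k).comp measurable_snd).const_mul C).ennreal_ofReal
      rw [B.lintegral_runLaw_succ hm (hms (n + 1)), ← lintegral_add_left (hms n)]
      refine lintegral_congr fun x => ?_
      simp only [sumWidth_snoc, lintegral_const, measure_univ, mul_one, mul_add]
      have h : ∀ s, ENNReal.ofReal (C * B.sumWidth n x.2 + C * √(B.margVar x.2 (sel s))) =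
          ENNReal.ofReal (C * B.sumWidth n x.2) +
            ENNReal.ofReal (C * √(B.margVar x.2 (sel s))) := fun s =>
        ENNReal.ofReal_add (mul_nonneg hC0 (B.sumWidth_nonneg _))
          (mul_nonneg hC0 (Real.sqrt_nonneg _))
      simp_rw [h]
      rw [lintegral_add_left measurable_const, lintegral_const, measure_univ, mul_one]
    rw [e1, e2]
    calc _ ≤ _ := add_le_add ih (B.lintegral_round_le hB hsel hδ n)
      _ = _ := by push_cast; ring

theorem complexity_nonneg {c : ℝ} (hc : 0 ≤ c) (n : ℕ) : 0 ≤ B.complexity n c := by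
  refine Finset.sum_nonneg fun i _ => mul_nonneg (by positivity) ?_
  refine mul_nonneg (B.weightCoeff_nonneg i) ?_
  split_ifs
  · refine Real.log_nonneg ?_
    have : 0 ≤ B.σ₀ i ^ 2 * n / B.σ ^ 2 := by positivity
    linarith
  · refine Real.log_nonneg ?_
    have : 0 ≤ B.σ₀ i ^ 2 * ∑ j ∈ children i, (B.σ₀ j ^ 2)⁻¹ :=
      mul_nonneg (sq_nonneg _) (Finset.sum_nonneg fun j _ => by positivity)
    linarith

theorem lintegral_regret_le_bound (hB : B.Valid) (hsel : IsArgmax sel) {n : ℕ} {c : ℝ}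
    (hc : 0 < c) (hsc : B.PosteriorScaling n c) {δ : ℝ} (hδ : 0 < δ) :
    ∫⁻ x, ENNReal.ofReal (regret x) ∂B.runLaw sel n ≤
      ENNReal.ofReal (B.bound n (B.complexity n c) δ) := by
  have := B.isProbabilityMeasure_runLaw hsel.measurable n
  have hG := B.complexity_nonneg hc.le n
  have hS : ∀ x : (T → ℝ) × History T n, √(2 * Real.log (1 / δ)) * B.sumWidth n x.2 ≤
      √(2 * n * B.complexity n c * Real.log (1 / δ)) := fun x => by
    have h1 : B.sumWidth n x.2 ≤ √(n * B.complexity n c) := by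
      refine Real.le_sqrt_of_sq_le ((B.sumWidth_sq_le x.2).trans ?_)
      gcongr
      exact B.sumVar_le_complexity hB hc hsc x.2
    calc _ ≤ √(2 * Real.log (1 / δ)) * √(n * B.complexity n c) := by gcongr
      _ = √(2 * Real.log (1 / δ) * (n * B.complexity n c)) := by
        -- Only the second factor has to be nonnegative: for `δ > 1` the logarithm is negative and
        -- both sides are `0`.
        rw [Real.sqrt_mul' (2 * Real.log (1 / δ)) (by positivity)]
      _ = _ := by congr 1; ring
  -- The tail bound `δ/2` per arm and round fits into the stated constant.
  have hpi : 1 / 2 ≤ √(2 / Real.pi) := by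
    refine Real.le_sqrt_of_sq_le ?_
    rw [le_div_iff₀ Real.pi_pos]
    have := Real.pi_le_four
    linarith
  calc _ ≤ _ := B.lintegral_regret_le hB hsel hδ n
    _ ≤ ∫⁻ _, ENNReal.ofReal (√(2 * n * B.complexity n c * Real.log (1 / δ))) ∂B.runLaw sel n +
        n * ENNReal.ofReal (Nat.card (Leaf T) * (B.sigmaMax * (δ / 2))) := by
      gcongr with x
      exact hS x
    _ = ENNReal.ofReal (√(2 * n * B.complexity n c * Real.log (1 / δ)) +
        n * (Nat.card (Leaf T) * (B.sigmaMax * (δ / 2)))) := by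
      have h0 := B.sigmaMax_nonneg
      rw [lintegral_const, measure_univ, mul_one, ENNReal.ofReal_add (Real.sqrt_nonneg _)
        (by positivity), ENNReal.ofReal_mul (Nat.cast_nonneg n), ENNReal.ofReal_natCast]
    _ ≤ _ := by
      refine ENNReal.ofReal_le_ofReal ?_
      unfold bound
      have h0 := B.sigmaMax_nonneg
      have h1 : 0 ≤ n * (Nat.card (Leaf T) * (B.sigmaMax * δ)) := by positivity
      have := mul_le_mul_of_nonneg_right hpi h1
      linarith

theorem bound_nonneg (n : ℕ) (G : ℝ) {δ : ℝ} (hδ : 0 < δ) : 0 ≤ B.bound n G δ := by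
  have h0 := B.sigmaMax_nonneg
  unfold bound
  positivity

theorem integrable_regret (hB : B.Valid) (hsel : IsArgmax sel) {n : ℕ} {c : ℝ}
    (hc : 0 < c) (hsc : B.PosteriorScaling n c) : Integrable regret (B.runLaw sel n) := by
  refine ⟨(measurable_regret hsel).aestronglyMeasurable, ?_⟩
  rw [hasFiniteIntegral_iff_ofReal (Eventually.of_forall (regret_nonneg hsel))]
  exact (B.lintegral_regret_le_bound hB hsel hc hsc one_pos).trans_lt ENNReal.ofReal_lt_top

theorem bayesRegret_le (hB : B.Valid) (hsel : IsArgmax sel) {n : ℕ} {c : ℝ}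
    (hc : 0 < c) (hsc : B.PosteriorScaling n c) {δ : ℝ} (hδ : 0 < δ) :
    B.bayesRegret sel n ≤ B.bound n (B.complexity n c) δ := by
  rw [bayesRegret, integral_eq_lintegral_of_nonneg_ae (Eventually.of_forall (regret_nonneg hsel))
    (measurable_regret hsel).aestronglyMeasurable]
  exact ENNReal.toReal_le_of_le_ofReal (B.bound_nonneg n _ hδ)
    (B.lintegral_regret_le_bound hB hsel hc hsc hδ)

end TreeBandit

/-! ### The order of the bound for `δ = 1/n` -/

theorem nodeHeight_le_bot {T : RootedTree.{u}} [Fintype T] (i : T) :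
    nodeHeight i ≤ nodeHeight (⊥ : T) :=
  ENat.toNat_le_toNat (Order.coheight_anti bot_le) (coheight_lt_top _).ne

open scoped Classical in
-- The ancestors of a node form a chain, along which the height is strictly monotone and hence
-- injective.
theorem card_ancestors_le {T : RootedTree.{u}} [Fintype T] (i : T) :
    (Finset.univ.filter fun j : T => j ≤ i).card ≤ nodeHeight (⊥ : T) + 1 := by
  rw [← Finset.card_range (nodeHeight (⊥ : T) + 1)]
  refine Finset.card_le_card_of_injOn nodeHeight (fun j _ => ?_) fun j hj k hk hjk => ?_
  · simpa [Nat.lt_succ_iff] using nodeHeight_le_bot j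
  · simp only [Finset.coe_filter, Finset.mem_univ, true_and, Set.mem_ofPred_eq] at hj hk
    rcases (le_total_of_directed hj hk).symm with h | h
    · by_contra hne
      exact (nodeHeight_lt_of_lt (lt_of_le_of_ne h hne)).ne' hjk
    · by_contra hne
      exact (nodeHeight_lt_of_lt (lt_of_le_of_ne h (Ne.symm hne))).ne hjk

theorem children_eq_of_le {T : RootedTree.{u}} [Fintype T] {i j k a : T} (hj : j ∈ children i)
    (hk : k ∈ children i) (hja : j ≤ a) (hka : k ≤ a) : j = k := by
  rw [mem_children] at hj hk
  rcases (le_total_of_directed hja hka).symm with h | h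
  · by_contra hne
    exact hk.2 hj.lt (lt_of_le_of_ne h hne)
  · by_contra hne
    exact hj.2 hk.lt (lt_of_le_of_ne h (Ne.symm hne))

namespace TreeBandit

variable {T : RootedTree.{u}}

/-- This is `log (1 + X) ≥ X / (1 + X)` with `X = σ₀² / σ²`. -/
theorem weightCoeff_le (B : TreeBandit T) (hσ : 0 < B.σ) (i : T) :
    B.weightCoeff i ≤ B.σ ^ 2 + B.σ₀ i ^ 2 := by
  unfold weightCoeff
  by_cases h0 : B.σ₀ i = 0
  · simp [h0, sq_nonneg]
  · have hX : 0 < B.σ₀ i ^ 2 / B.σ ^ 2 := by positivity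
    have h1 := Real.one_sub_inv_le_log_of_pos (show 0 < 1 + B.σ₀ i ^ 2 / B.σ ^ 2 by positivity)
    rw [div_le_iff₀ (Real.log_pos (by linarith))]
    calc B.σ₀ i ^ 2 = (B.σ ^ 2 + B.σ₀ i ^ 2) * (1 - (1 + B.σ₀ i ^ 2 / B.σ ^ 2)⁻¹) := by
          field_simp
          ring
      _ ≤ _ := by gcongr

variable [Fintype T] (B : TreeBandit T) {t : ℕ}

open scoped Classical in
-- One observation affects only the path from the action to the root. On it, at most one child of
-- each node changes its message, and gains shrink on the way up because the denominators are at
-- least `1`.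
theorem likPrec_sub_init_le (H : History T (t + 1)) (i : T) :
    B.likPrec H i - B.likPrec (t := t) (Fin.init H) i ≤
      if i ≤ (H (Fin.last t)).1 then 1 / B.σ ^ 2 else 0 := by
  induction i using WellFoundedGT.induction with
  | ind i ih =>
    by_cases hi : IsMax i
    · rw [likPrec_of_isMax _ _ hi, likPrec_of_isMax _ _ hi, card_rounds_succ, ← sub_div]
      by_cases ha : ((H (Fin.last t)).1 : T) = i
      · rw [if_pos ha, if_pos ha.ge]
        simp
      · rw [if_neg ha, if_neg fun h => ha (hi.eq_of_ge h)]
        simp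
    · rw [likPrec_of_not_isMax _ _ hi, likPrec_of_not_isMax _ _ hi, ← Finset.sum_sub_distrib]
      have h1 : ∀ j ∈ children i, B.msgPrec H j - B.msgPrec (t := t) (Fin.init H) j ≤
          if j ≤ (H (Fin.last t)).1 then 1 / B.σ ^ 2 else 0 := fun j hj => by
        refine le_trans ?_ (ih j (lt_of_mem_children hj))
        rw [msgPrec_sub_msgPrec_init]
        refine div_le_self (sub_nonneg.2 (B.likPrec_init_le H j)) ?_
        have e1 := mul_nonneg (sq_nonneg (B.σ₀ j)) (B.likPrec_nonneg H j)
        have e2 := mul_nonneg (sq_nonneg (B.σ₀ j)) (B.likPrec_nonneg (t := t) (Fin.init H) j)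
        exact one_le_mul_of_one_le_of_one_le (by linarith) (by linarith)
      refine (Finset.sum_le_sum h1).trans ?_
      rw [← Finset.sum_filter, Finset.sum_const, nsmul_eq_mul]
      split_ifs with ha
      · have hcard :
            (Finset.filter (fun j => j ≤ ((H (Fin.last t)).1 : T)) (children i)).card ≤ 1 :=
          Finset.card_le_one.2 fun j hj k hk => by
            rw [Finset.mem_filter] at hj hk
            exact children_eq_of_le hj.1 hk.1 hj.2 hk.2
        exact mul_le_of_le_one_left (by positivity) (by exact_mod_cast hcard)
      · rw [Finset.filter_false_of_mem fun j hj h => ha ((lt_of_mem_children hj).le.trans h)]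
        simp

/-- A round adds at most `hi² / σ²` to `1 + σ₀² M`, which is at least `1`, so the increase is
absorbed by a factor. -/
theorem posteriorScaling_of_le (hB : B.Valid) {hi : ℝ} (h : ∀ i, B.σ₀ i ≤ hi) (n : ℕ) :
    B.PosteriorScaling n (1 + hi ^ 2 / B.σ ^ 2) := by
  classical
  intro t _ H i
  have hσ := hB.noise_pos
  rcases (hB.nonneg i).eq_or_lt with h0 | h0
  -- For a certain root both inverses are `0⁻¹ = 0`.
  · simp [postVar, ← h0]
  · rw [postVar, postVar, inv_div, inv_div, ← mul_div_assoc]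
    gcongr
    have h1 : B.likPrec H i - B.likPrec (t := t) (Fin.init H) i ≤ 1 / B.σ ^ 2 := by
      refine (B.likPrec_sub_init_le H i).trans ?_
      split_ifs
      · exact le_rfl
      · positivity
    have hM := B.likPrec_nonneg (t := t) (Fin.init H) i
    have h2 : B.σ₀ i ^ 2 * (B.likPrec H i - B.likPrec (t := t) (Fin.init H) i) ≤
        hi ^ 2 / B.σ ^ 2 := by
      calc _ ≤ hi ^ 2 * (1 / B.σ ^ 2) := by
            have := h i
            have := sub_nonneg.2 (B.likPrec_init_le H i)
            gcongr
        _ = _ := by ring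
    have h3 : 0 ≤ hi ^ 2 / B.σ ^ 2 * (B.σ₀ i ^ 2 * B.likPrec (t := t) (Fin.init H) i) := by
      positivity
    nlinarith

theorem weight_le (hB : B.Valid) {lo hi : ℝ} (hlo : 0 < lo) (hle : ∀ i, B.σ₀ i ≤ hi)
    (hge : ∀ i, i ≠ ⊥ → lo ≤ B.σ₀ i) {n : ℕ} (hn : 1 ≤ n) (i : T) :
    B.weight n i ≤ (B.σ ^ 2 + hi ^ 2) * ((1 + hi ^ 2 / B.σ ^ 2 + hi ^ 2 / lo ^ 2) *
      Real.log (1 + n * Fintype.card T)) := by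
  have hσ := hB.noise_pos
  have h0 := hB.nonneg i
  have hhi := hle i
  have hn' : (1 : ℝ) ≤ n := by exact_mod_cast hn
  have hV : (1 : ℝ) ≤ Fintype.card T := by
    exact_mod_cast Fintype.card_pos_iff.2 ⟨i⟩
  have hX : (0 : ℝ) ≤ n * Fintype.card T := by positivity
  -- One constant serves both kinds of nodes: `hi²/σ²` handles actions, `hi²/lo²` inner nodes, and
  -- the `1` allows it to be pulled out of the logarithm by `log_one_add_mul_le`.
  have hD : 1 ≤ 1 + hi ^ 2 / B.σ ^ 2 + hi ^ 2 / lo ^ 2 := by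
    have : 0 ≤ hi ^ 2 / B.σ ^ 2 + hi ^ 2 / lo ^ 2 := by positivity
    linarith
  have hD1 : hi ^ 2 / B.σ ^ 2 ≤ 1 + hi ^ 2 / B.σ ^ 2 + hi ^ 2 / lo ^ 2 := by
    have : 0 ≤ hi ^ 2 / lo ^ 2 := by positivity
    linarith
  have hD2 : hi ^ 2 / lo ^ 2 ≤ 1 + hi ^ 2 / B.σ ^ 2 + hi ^ 2 / lo ^ 2 := by
    have : 0 ≤ hi ^ 2 / B.σ ^ 2 := by positivity
    linarith
  have hcoeff : B.weightCoeff i ≤ B.σ ^ 2 + hi ^ 2 :=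
    (B.weightCoeff_le hσ i).trans (by gcongr)
  have hlog : 0 ≤ Real.log (1 + n * Fintype.card T) := Real.log_nonneg (by linarith)
  have key : ∀ x : ℝ, 0 ≤ x → x ≤ (1 + hi ^ 2 / B.σ ^ 2 + hi ^ 2 / lo ^ 2) *
      (n * Fintype.card T) → B.weightCoeff i * Real.log (1 + x) ≤ (B.σ ^ 2 + hi ^ 2) *
        ((1 + hi ^ 2 / B.σ ^ 2 + hi ^ 2 / lo ^ 2) * Real.log (1 + n * Fintype.card T)) := by
    intro x hx hle
    have h2 : Real.log (1 + x) ≤ (1 + hi ^ 2 / B.σ ^ 2 + hi ^ 2 / lo ^ 2) *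
        Real.log (1 + n * Fintype.card T) :=
      (Real.log_le_log (by linarith) (by linarith)).trans (log_one_add_mul_le hD hX)
    exact mul_le_mul hcoeff h2 (Real.log_nonneg (by linarith)) (by positivity)
  unfold weight
  split_ifs with hm
  · refine key _ (by positivity) ?_
    calc B.σ₀ i ^ 2 * n / B.σ ^ 2 ≤ hi ^ 2 * n / B.σ ^ 2 := by gcongr
      _ = hi ^ 2 / B.σ ^ 2 * (n * 1) := by ring
      _ ≤ _ := by gcongr
  · refine key _ (mul_nonneg (sq_nonneg _) (Finset.sum_nonneg fun j _ => by positivity)) ?_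
    have hsum : ∑ j ∈ children i, (B.σ₀ j ^ 2)⁻¹ ≤ Fintype.card T * (lo ^ 2)⁻¹ := by
      calc ∑ j ∈ children i, (B.σ₀ j ^ 2)⁻¹ ≤ ∑ j ∈ children i, (lo ^ 2)⁻¹ := by
            refine Finset.sum_le_sum fun j hj => ?_
            have := hge j fun h => (h ▸ lt_of_mem_children hj).not_ge bot_le
            gcongr
        _ = (children i).card * (lo ^ 2)⁻¹ := by rw [Finset.sum_const, nsmul_eq_mul]
        _ ≤ _ := by
          gcongr
          exact Finset.card_le_univ _
    calc B.σ₀ i ^ 2 * ∑ j ∈ children i, (B.σ₀ j ^ 2)⁻¹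
        ≤ hi ^ 2 * (Fintype.card T * (lo ^ 2)⁻¹) := by gcongr
      _ = hi ^ 2 / lo ^ 2 * (1 * Fintype.card T) := by rw [one_mul, div_eq_mul_inv]; ring
      _ ≤ _ := by gcongr

theorem complexity_le (hB : B.Valid) {lo hi : ℝ} (hlo : 0 < lo) (hle : ∀ i, B.σ₀ i ≤ hi)
    (hge : ∀ i, i ≠ ⊥ → lo ≤ B.σ₀ i) {h : ℕ} (hh : nodeHeight (⊥ : T) ≤ h) {n : ℕ} (hn : 1 ≤ n) :
    B.complexity n (1 + hi ^ 2 / B.σ ^ 2) ≤ (1 + hi ^ 2 / B.σ ^ 2) ^ h *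
      ((B.σ ^ 2 + hi ^ 2) * (1 + hi ^ 2 / B.σ ^ 2 + hi ^ 2 / lo ^ 2)) *
        (Fintype.card T * Real.log (1 + n * Fintype.card T)) := by
  have hc : 1 ≤ 1 + hi ^ 2 / B.σ ^ 2 := by
    have : 0 ≤ hi ^ 2 / B.σ ^ 2 := by positivity
    linarith
  have hlog : 0 ≤ Real.log (1 + n * Fintype.card T) := Real.log_nonneg (by
    have : (0 : ℝ) ≤ n * Fintype.card T := by positivity
    linarith)
  calc B.complexity n (1 + hi ^ 2 / B.σ ^ 2)
      ≤ ∑ _i : T, (1 + hi ^ 2 / B.σ ^ 2) ^ h * ((B.σ ^ 2 + hi ^ 2) *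
        ((1 + hi ^ 2 / B.σ ^ 2 + hi ^ 2 / lo ^ 2) * Real.log (1 + n * Fintype.card T))) := by
        refine Finset.sum_le_sum fun i _ => ?_
        have h1 := pow_le_pow_right₀ hc ((nodeHeight_le_bot i).trans hh)
        exact (mul_le_mul_of_nonneg_left (B.weight_le hB hlo hle hge hn i) (by positivity)).trans
          (mul_le_mul_of_nonneg_right h1 (by positivity))
    _ = _ := by
      rw [Finset.sum_const, nsmul_eq_mul, Finset.card_univ]
      ring

theorem sigmaMax_le (hB : B.Valid) {hi : ℝ} (hle : ∀ i, B.σ₀ i ≤ hi) {h : ℕ}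
    (hh : nodeHeight (⊥ : T) ≤ h) : B.sigmaMax ≤ hi * √(h + 1) := by
  classical
  have h0 : 0 ≤ hi := (hB.nonneg ⊥).trans (hle ⊥)
  refine Real.iSup_le (fun a => ?_) (by positivity)
  rw [← Real.sqrt_sq h0, ← Real.sqrt_mul (sq_nonneg _)]
  refine Real.sqrt_le_sqrt ?_
  calc _ ≤ ∑ j ∈ Finset.univ.filter (fun j : T => j ≤ a), hi ^ 2 := by
        refine Finset.sum_le_sum fun j _ => ?_
        have h1 := hle j
        have h2 := hB.nonneg j
        gcongr
    _ = (Finset.univ.filter (fun j : T => j ≤ a)).card * hi ^ 2 := by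
        rw [Finset.sum_const, nsmul_eq_mul]
    _ ≤ (h + 1) * hi ^ 2 := by
        gcongr
        exact_mod_cast (card_ancestors_le (a : T)).trans (by omega)
    _ = _ := mul_comm _ _

/-- For `δ = 1/n` the factor `n δ` is `1`, and `log n` is at most `L`, so the radicand is at most `2
E n |V| L²`. -/
theorem bound_one_div_le {n : ℕ} (hn : 1 ≤ n) {G E : ℝ} (hE : 0 ≤ E)
    (hG : G ≤ E * (Fintype.card T * Real.log (1 + n * Fintype.card T))) :
    B.bound n G (1 / n) ≤ √(2 * E) * √(n * Fintype.card T) * Real.log (1 + n * Fintype.card T) +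
      √(2 / Real.pi) * B.sigmaMax * Nat.card (Leaf T) := by
  have hn' : (1 : ℝ) ≤ n := by exact_mod_cast hn
  have hn0 : (n : ℝ) ≠ 0 := by positivity
  have hV : (1 : ℝ) ≤ Fintype.card T := by
    exact_mod_cast Fintype.card_pos_iff.2 ⟨(⊥ : T)⟩
  have hX : (n : ℝ) ≤ n * Fintype.card T := le_mul_of_one_le_right (by positivity) hV
  set L := Real.log (1 + n * Fintype.card T) with hL
  have hlogn : 0 ≤ Real.log n := Real.log_nonneg hn'
  have hlog : Real.log n ≤ L := Real.log_le_log (by positivity) (by linarith)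
  have hL0 : 0 ≤ L := hlogn.trans hlog
  unfold bound
  rw [one_div_one_div, mul_assoc _ (n : ℝ) (1 / n), mul_one_div_cancel hn0, mul_one]
  gcongr
  calc √(2 * n * G * Real.log n)
      ≤ √((2 * E) * (n * Fintype.card T) * L ^ 2) := by
        refine Real.sqrt_le_sqrt ?_
        calc 2 * n * G * Real.log n ≤ 2 * n * (E * (Fintype.card T * L)) * L := by gcongr
          _ = _ := by ring
    _ = _ := by rw [Real.sqrt_mul' _ (sq_nonneg L), Real.sqrt_sq hL0,
          Real.sqrt_mul (by positivity)]

theorem card_leaf_le_sqrt {n : ℕ} (hK : Nat.card (Leaf T) ≤ n) :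
    (Nat.card (Leaf T) : ℝ) ≤ √(n * Fintype.card T) := by
  refine Real.le_sqrt_of_sq_le ?_
  have h : Nat.card (Leaf T) ≤ Fintype.card T := by
    rw [← Nat.card_eq_fintype_card]
    exact Nat.card_le_card_of_injective _ Subtype.val_injective
  rw [sq]
  gcongr

end TreeBandit

/-! ### Trees of height one: the flat bandit -/

section Flat

variable {T : RootedTree.{u}}

theorem not_isMax_bot_of_height_one (hT : nodeHeight (⊥ : T) = 1) : ¬ IsMax (⊥ : T) := fun h => by
  rw [nodeHeight_of_isMax h] at hT
  exact zero_ne_one hT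

variable [Fintype T]

theorem isMax_iff_ne_bot (hT : nodeHeight (⊥ : T) = 1) {i : T} : IsMax i ↔ i ≠ ⊥ := by
  constructor
  · rintro h rfl
    exact not_isMax_bot_of_height_one hT h
  · intro hi
    have h1 := nodeHeight_lt_of_lt (bot_lt_iff_ne_bot.2 hi)
    rw [hT, Nat.lt_one_iff, nodeHeight, ENat.toNat_eq_zero] at h1
    exact Order.coheight_eq_zero.1 (h1.resolve_right (coheight_lt_top i).ne)

theorem sum_eq_bot_add_sum_leaf [Fintype (Leaf T)] (hT : nodeHeight (⊥ : T) = 1) (f : T → ℝ) :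
    ∑ i, f i = f ⊥ + ∑ a : Leaf T, f a := by
  classical
  rw [← Finset.add_sum_erase _ _ (Finset.mem_univ (⊥ : T))]
  congr 1
  exact Finset.sum_subtype _ (fun i => by simp [isMax_iff_ne_bot hT]) f

theorem pred_leaf_eq_bot (hT : nodeHeight (⊥ : T) = 1) (a : Leaf T) : Order.pred (a : T) = ⊥ := by
  have ha := (isMax_iff_ne_bot hT).1 a.2
  by_contra h
  exact ((isMax_iff_ne_bot hT).2 h).not_lt (pred_lt_of_ne_bot ha)

/-- With a deterministic root, each leaf is a function of its own noise only, whence independence.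
-/
theorem map_treeLaw_leaf [Fintype (Leaf T)] (hT : nodeHeight (⊥ : T) = 1) {m : T → ℝ → ℝ}
    {s : T → ℝ} {μ : ℝ} (hm : ∀ i, Measurable (m i)) (hs : s ⊥ = 0) :
    (treeLaw m s μ).map (fun θ (a : Leaf T) => θ a) =
      Measure.pi fun a : Leaf T => gaussianReal (m a (m ⊥ μ)) (s a ^ 2).toNNReal := by
  have he : ∀ (ξ : T → ℝ) (a : Leaf T), treeEval m s μ ξ a = m a (m ⊥ μ) + s a * ξ a := by
    intro ξ a
    rw [treeEval_eq, parentEval, if_neg ((isMax_iff_ne_bot hT).1 a.2), pred_leaf_eq_bot hT,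
      treeEval_eq, parentEval, if_pos rfl, hs, zero_mul, add_zero]
  rw [treeLaw, Measure.map_map (by fun_prop) (measurable_treeEval hm)]
  simp only [Function.comp_def, he]
  have hX : iIndepFun (fun (i : T) (ξ : T → ℝ) => m i (m ⊥ μ) + s i * ξ i)
      (Measure.pi fun _ : T => gaussianReal 0 1) :=
    iIndepFun_pi (X := fun i x => m i (m ⊥ μ) + s i * x) fun i => by fun_prop
  have hmeas : ∀ (i : T) (x y : ℝ), Measurable fun ξ : T → ℝ => x + y * ξ i := fun i x y => by
    fun_prop
  have hae : ∀ a : Leaf T, AEMeasurable (fun ξ : T → ℝ => m a (m ⊥ μ) + s a * ξ a)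
      (Measure.pi fun _ : T => gaussianReal 0 1) := fun a => (hmeas a _ _).aemeasurable
  have h := (iIndepFun_iff_map_fun_eq_pi_map hae).1
    (hX.precomp (g := fun a : Leaf T => (a : T)) Subtype.val_injective)
  rw [h]
  congr 1
  funext a
  have hev := (measurePreserving_eval (fun _ : T => gaussianReal 0 1) (a : T)).map_eq
  rw [show (fun ξ : T → ℝ => m a (m ⊥ μ) + s a * ξ a) =
      (fun x => m a (m ⊥ μ) + x) ∘ (fun x => s a * x) ∘ Function.eval (a : T) from rfl,
    ← Measure.map_map (by fun_prop) (by fun_prop), ← Measure.map_map (by fun_prop) (by fun_prop),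
    hev, gaussianReal_map_const_mul, gaussianReal_map_const_add]
  congr 1
  · simp
  · ext; simp [sq_nonneg]

end Flat

namespace TreeBandit

variable {T : RootedTree.{u}} [Fintype T] (B : TreeBandit T)

theorem complexity_of_height_one [Fintype (Leaf T)] (hT : nodeHeight (⊥ : T) = 1) (n : ℕ) (c : ℝ) :
    B.complexity n c = c * B.weight n ⊥ + ∑ a : Leaf T, B.weight n a := by
  rw [complexity, sum_eq_bot_add_sum_leaf hT, hT, pow_one]
  congr 1
  exact Finset.sum_congr rfl fun a _ => by rw [nodeHeight_of_isMax a.2, pow_zero, one_mul]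

/-- Only the root weight depends on `s`. Its coefficient stays below `σ² + s²` and its logarithm
tends to `0`, so it is squeezed to zero. -/
theorem tendsto_complexity_withRoot [Fintype (Leaf T)] (hB : B.Valid)
    (hT : nodeHeight (⊥ : T) = 1) (n : ℕ) (c : ℝ) :
    Tendsto (fun s => (B.withRoot s).complexity n c) (𝓝[>] 0)
      (𝓝 (∑ a : Leaf T, B.weight n a)) := by
  classical
  have hbot := not_isMax_bot_of_height_one hT
  have hleaf : ∀ (s : ℝ) (a : Leaf T), (B.withRoot s).weight n a = B.weight n a := fun s a => by
    simp [weight, withRoot, (isMax_iff_ne_bot hT).1 a.2, a.2]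
  set S := ∑ j ∈ children (⊥ : T), (B.σ₀ j ^ 2)⁻¹ with hS
  have hS0 : 0 ≤ S := Finset.sum_nonneg fun j _ => by positivity
  have hroot : ∀ s : ℝ, (B.withRoot s).weight n ⊥ =
      (B.withRoot s).weightCoeff ⊥ * Real.log (1 + s ^ 2 * S) := fun s => by
    have hsum : ∑ j ∈ children (⊥ : T), ((B.withRoot s).σ₀ j ^ 2)⁻¹ = S :=
      Finset.sum_congr rfl fun j hj => by
        simp [withRoot, (lt_of_mem_children hj).ne']
    rw [weight, if_neg hbot, hsum, weightCoeff]
    simp [withRoot]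
  have hlog : ∀ s : ℝ, 0 ≤ Real.log (1 + s ^ 2 * S) := fun s => Real.log_nonneg (by
    have : 0 ≤ s ^ 2 * S := by positivity
    linarith)
  have hlim : Tendsto (fun s => (B.withRoot s).weight n ⊥) (𝓝[>] 0) (𝓝 0) := by
    have hup : Tendsto (fun s : ℝ => (B.σ ^ 2 + s ^ 2) * Real.log (1 + s ^ 2 * S)) (𝓝[>] 0)
        (𝓝 0) := by
      have hcont : ContinuousAt (fun s : ℝ => (B.σ ^ 2 + s ^ 2) * Real.log (1 + s ^ 2 * S)) 0 := by
        refine ContinuousAt.mul (by fun_prop) (ContinuousAt.log (by fun_prop) ?_)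
        norm_num
      have h := hcont.tendsto
      simp only [ne_eq, OfNat.ofNat_ne_zero, not_false_eq_true, zero_pow, zero_mul, add_zero,
        Real.log_one, mul_zero] at h
      exact h.mono_left nhdsWithin_le_nhds
    refine squeeze_zero (fun s => ?_) (fun s => ?_) hup
    · rw [hroot]
      exact mul_nonneg (weightCoeff_nonneg _ _) (hlog s)
    · rw [hroot]
      refine mul_le_mul_of_nonneg_right ?_ (hlog s)
      simpa [withRoot] using (B.withRoot s).weightCoeff_le hB.noise_pos ⊥
  simp_rw [complexity_of_height_one _ hT, hleaf]
  simpa using (hlim.const_mul c).add_const (∑ a : Leaf T, B.weight n a)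

theorem map_prior_leaf [Fintype (Leaf T)] (hT : nodeHeight (⊥ : T) = 1) (h0 : B.σ₀ ⊥ = 0) :
    B.prior.map (fun θ (a : Leaf T) => θ a) =
      Measure.pi (fun a : Leaf T => gaussianReal B.μ (B.σ₀ a ^ 2).toNNReal) :=
  map_treeLaw_leaf hT (fun _ => measurable_id) h0

theorem map_sampleLaw_leaf [Fintype (Leaf T)] (hB : B.Valid) (hT : nodeHeight (⊥ : T) = 1)
    (h0 : B.σ₀ ⊥ = 0) {t : ℕ} (H : History T t) :
    (B.sampleLaw H).map (fun θ (a : Leaf T) => θ a) =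
      Measure.pi (fun a : Leaf T => gaussianReal
        ((B.μ / B.σ₀ a ^ 2 + (∑ l ∈ rounds H a, (H l).2) / B.σ ^ 2) /
          (1 / B.σ₀ a ^ 2 + (rounds H a).card / B.σ ^ 2))
        (1 / (1 / B.σ₀ a ^ 2 + (rounds H a).card / B.σ ^ 2)).toNNReal) := by
  rw [sampleLaw, map_treeLaw_leaf hT (B.measurable_postMean H) (by simp [postVar, h0])]
  congr 1
  funext a
  have hσ := hB.noise_pos
  have ha := hB.node_pos a ((isMax_iff_ne_bot hT).1 a.2)
  have hroot : B.postMean H ⊥ B.μ = B.μ := by simp [postMean, h0]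
  have hM := B.likPrec_of_isMax H a.2
  have hD : 1 + B.σ₀ a ^ 2 * ((rounds H a).card / B.σ ^ 2) =
      B.σ₀ a ^ 2 * (1 / B.σ₀ a ^ 2 + (rounds H a).card / B.σ ^ 2) := by
    field_simp
  congr 1
  · rw [hroot, postMean, B.likPrec_mul_msgMean_of_isMax H a.2, ← Finset.mul_sum, hM, hD,
      one_div_mul_eq_div, ← mul_div_mul_left _ (1 / B.σ₀ a ^ 2 + _) (pow_pos ha 2).ne']
    congr 1
    field_simp
  · rw [Real.sq_sqrt (B.postVar_nonneg H a), postVar, hM, hD, ← div_div,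
      div_self (pow_pos ha 2).ne']

theorem sigmaMax_of_height_one (hB : B.Valid) (hT : nodeHeight (⊥ : T) = 1) (h0 : B.σ₀ ⊥ = 0) :
    B.sigmaMax = ⨆ a : Leaf T, B.σ₀ a := by
  classical
  unfold sigmaMax
  congr 1
  funext a
  have ha := (isMax_iff_ne_bot hT).1 a.2
  have hset : Finset.univ.filter (fun j : T => j ≤ a) = {⊥, (a : T)} := by
    ext j
    simp only [Finset.mem_filter, Finset.mem_univ, true_and, Finset.mem_insert,
      Finset.mem_singleton]
    constructor
    · intro h
      by_cases hj : j = ⊥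
      · exact Or.inl hj
      · exact Or.inr (((isMax_iff_ne_bot hT).2 hj).eq_of_le h)
    · rintro (rfl | rfl)
      · exact bot_le
      · exact le_rfl
  rw [hset, Finset.sum_pair ha.symm, h0, zero_pow two_ne_zero, zero_add,
    Real.sqrt_sq (hB.nonneg a)]

theorem bayesRegret_le_of_height_one [Fintype (Leaf T)] (hB : B.Valid)
    (hT : nodeHeight (⊥ : T) = 1) (h0 : B.σ₀ ⊥ = 0) {sel : (T → ℝ) → Leaf T}
    (hsel : IsArgmax sel) (n : ℕ) {δ : ℝ} (hδ : 0 < δ) :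
    B.bayesRegret sel n ≤ B.bound n (∑ a : Leaf T, B.weight n a) δ := by
  -- Any admissible `c` will do, as it multiplies only the root weight, which is zero; the sum of
  -- all widths is a convenient upper bound for each of them.
  have hsc := B.posteriorScaling_of_le hB (hi := ∑ i, B.σ₀ i)
    (fun i => Finset.single_le_sum (fun j _ => hB.nonneg j) (Finset.mem_univ i)) n
  have h := B.bayesRegret_le hB hsel (by positivity) hsc hδ
  have hw : B.weight n ⊥ = 0 := by simp [weight, h0]
  rwa [complexity_of_height_one _ hT, hw, mul_zero, zero_add] at h

end TreeBandit

theorem theorem1 :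
    -- the regret bound
    (∀ (T : RootedTree.{u}) [Fintype T] (B : TreeBandit T) (sel : (T → ℝ) → Leaf T)
        (n : ℕ) (c : ℝ),
      B.Valid → TreeBandit.IsArgmax sel → 0 < c → B.PosteriorScaling n c →
      Integrable TreeBandit.regret (B.runLaw sel n) ∧
      ∀ δ : ℝ, 0 < δ → B.bayesRegret sel n ≤ B.bound n (B.complexity n c) δ) ∧
    -- its order for `δ = 1 / n`
    (∀ (lo hi σ : ℝ) (h : ℕ), 0 < lo → lo ≤ hi → 0 < σ →
      ∃ C : ℝ, ∀ (T : RootedTree.{u}) [Fintype T] (B : TreeBandit T) (sel : (T → ℝ) → Leaf T)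
        (n : ℕ),
      B.Valid → B.σ = σ → (∀ i, B.σ₀ i ≤ hi) → (∀ i, i ≠ ⊥ → lo ≤ B.σ₀ i) →
      nodeHeight (⊥ : T) ≤ h → TreeBandit.IsArgmax sel → 1 ≤ n →
      B.bayesRegret sel n ≤ B.bound n (B.complexity n (1 + hi ^ 2 / σ ^ 2)) (1 / n) ∧
      B.bound n (B.complexity n (1 + hi ^ 2 / σ ^ 2)) (1 / n) ≤
        C * √(n * Fintype.card T) * Real.log (1 + n * Fintype.card T) +
          √(2 / Real.pi) * B.sigmaMax * Nat.card (Leaf T) ∧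
      (Nat.card (Leaf T) ≤ n →
        B.bound n (B.complexity n (1 + hi ^ 2 / σ ^ 2)) (1 / n) ≤
          C * √(n * Fintype.card T) * Real.log (1 + n * Fintype.card T))) ∧
    -- the flat bandit: a tree of height one whose root is certain
    (∀ (T : RootedTree.{u}) [Fintype T] [Fintype (Leaf T)] (B : TreeBandit T)
        (sel : (T → ℝ) → Leaf T) (n : ℕ),
      B.Valid → nodeHeight (⊥ : T) = 1 → TreeBandit.IsArgmax sel →
      (∀ c : ℝ, Tendsto (fun s => (B.withRoot s).complexity n c) (𝓝[>] 0)
        (𝓝 (∑ a : Leaf T, B.weight n a))) ∧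
      (B.σ₀ ⊥ = 0 →
        B.prior.map (fun θ (a : Leaf T) => θ a) =
          Measure.pi (fun a : Leaf T => gaussianReal B.μ (B.σ₀ a ^ 2).toNNReal) ∧
        (∀ (t : ℕ) (H : TreeBandit.History T t),
          (B.sampleLaw H).map (fun θ (a : Leaf T) => θ a) =
            Measure.pi (fun a : Leaf T => gaussianReal
              ((B.μ / B.σ₀ a ^ 2 + (∑ l ∈ TreeBandit.rounds H a, (H l).2) / B.σ ^ 2) /
                (1 / B.σ₀ a ^ 2 + (TreeBandit.rounds H a).card / B.σ ^ 2))
              (1 / (1 / B.σ₀ a ^ 2 + (TreeBandit.rounds H a).card / B.σ ^ 2)).toNNReal)) ∧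
        B.sigmaMax = (⨆ a : Leaf T, B.σ₀ a) ∧
        ∀ δ : ℝ, 0 < δ →
          B.bayesRegret sel n ≤ B.bound n (∑ a : Leaf T, B.weight n a) δ)) := by
  refine ⟨fun T _ B sel n c hB hsel hc hsc => ⟨B.integrable_regret hB hsel hc hsc,
    fun δ hδ => B.bayesRegret_le hB hsel hc hsc hδ⟩, ?_, ?_⟩
  · intro lo hi σ h hlo hle hσ
    have hhi := hlo.trans_le hle
    set E := (1 + hi ^ 2 / σ ^ 2) ^ h *
      ((σ ^ 2 + hi ^ 2) * (1 + hi ^ 2 / σ ^ 2 + hi ^ 2 / lo ^ 2)) with hE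
    have hE0 : 0 ≤ E := by positivity
    -- The second summand absorbs the term `√(2/π) σ_max K` when `K ≤ n`: there `σ_max ≤ hi √(h +
    -- 1)`, `K ≤ √(n |V|)`, and `log (1 + n |V|) ≥ log 2`.
    refine ⟨√(2 * E) + √(2 / Real.pi) * (hi * √(h + 1)) / Real.log 2, ?_⟩
    rintro T _ B sel n hB rfl hub hlb hh hsel hn
    have hV : (1 : ℝ) ≤ Fintype.card T := by
      exact_mod_cast Fintype.card_pos_iff.2 ⟨(⊥ : T)⟩
    have hn' : (1 : ℝ) ≤ n := by exact_mod_cast hn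
    have hlog2 : 0 < Real.log 2 := Real.log_pos one_lt_two
    have hlog : Real.log 2 ≤ Real.log (1 + n * Fintype.card T) :=
      Real.log_le_log two_pos (by nlinarith)
    have hσmax := B.sigmaMax_le hB hub hh
    have hb := B.bound_one_div_le hn hE0 (B.complexity_le hB hlo hub hlb hh hn)
    have hextra : 0 ≤ √(2 / Real.pi) * (hi * √(h + 1)) / Real.log 2 := by positivity
    refine ⟨B.bayesRegret_le hB hsel (by positivity) (B.posteriorScaling_of_le hB hub n)
      (by positivity), hb.trans ?_, fun hK => hb.trans ?_⟩
    · have hL := hlog2.le.trans hlog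
      gcongr
      linarith
    · have hK' := TreeBandit.card_leaf_le_sqrt hK
      have h0 := B.sigmaMax_nonneg
      rw [add_mul, add_mul]
      refine add_le_add le_rfl ?_
      calc √(2 / Real.pi) * B.sigmaMax * Nat.card (Leaf T)
          ≤ √(2 / Real.pi) * (hi * √(h + 1)) * √(n * Fintype.card T) := by gcongr
        _ = √(2 / Real.pi) * (hi * √(h + 1)) / Real.log 2 * √(n * Fintype.card T) *
            Real.log 2 := by field_simp
        _ ≤ _ := by gcongr
  · intro T _ _ B sel n hB hT hsel
    exact ⟨B.tendsto_complexity_withRoot hB hT n, fun h0 => ⟨B.map_prior_leaf hT h0,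
      fun t H => B.map_sampleLaw_leaf hB hT h0 H, B.sigmaMax_of_height_one hB hT h0,
      fun δ hδ => B.bayesRegret_le_of_height_one hB hT h0 hsel n hδ⟩⟩
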